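/- **Theorem (kernel for the free incomplete binary tree model).** An incomplete binary tree is a finite rooted plane tree in which each vertex has at most one left child and at most one right child. Let $T$ be the random incomplete binary tree in which each vertex has a left child with probability $1/2$ and, independently, a right child with probability $1/2$, all choices being independent; equivalently, $T$ is the Galton–Watson tree with offspring law $\xi=\frac14\delta_0+\frac12\delta_1+\frac14\delta_2$ and displacement laws $\eta^{(1)}=\frac12(\delta_{-1}+\delta_1)$, $\eta^{(2)}=\delta_{(-1,1)}$. Given the label of the root, label the other vertices so that a left child has the label of its parent minus one and a right child has the label of its parent plus one. Let $\Pi_x$ be the law of the labelled tree when the root has label $x$; thus a tree with $n$ edges has probability $4^{-n-1}$. Edges are oriented away from the root. Under $\Pi_0$, for $m\ge 1$, let $X_m^+$ be the number of edges from a vertex labelled $m-1$ to a vertex labelled $m$, and $X_m^-$ the number of edges from a vertex labelled $m$ to a vertex labelled $m-1$. Let $\mathfrak S=(\mathbb N_{>0}\times\mathbb N_{\ge 0})\cup\{(0,0)\}$. Let $\nu$ be the law, under $\Pi_1$, of the number of vertices labelled $0$ that have no strict ancestor labelled $0$. Let $f_k(l)=\mathbb P(S_k=l)$, where $S_0=0$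 and $S_k=N_1+\dots+N_k$ for i.i.d. variables $N_j$ with law $\nu$. Then the following holds. 1. For every $z\in[0,1]$, $$\sum_{k\ge 0}\nu(k)z^k=\frac{-z^2+16z-3+\sqrt{49-z}\,(1-z)^{3/2}}{2(z+5)}.$$ 2. For every $(p,q),(r,s)\in\mathfrak S$ and every $m\ge 1$, one has $f_p(q)>0$, $\Pi_0\big((X_m^+,X_m^-)=(p,q)\big)>0$ and $$\Pi_0\big((X_{m+1}^+,X_{m+1}^-)=(r,s)\,\big|\,(X_m^+,X_m^-)=(p,q)\big)=\mathbf P_{p,q}^{r,s},$$ where $$\mathbf P_{p,q}^{r,s}:=\frac{p\,4^{-p-s}}{p+s}\binom{p+s}{r}\binom{p+s}{q}\frac{f_r(s)}{f_p(q)},$$ with the conventions $\mathbf P_{0,0}^{0,0}=1$ and $\mathbf P_{0,0}^{r,s}=0$ for $(r,s)\ne(0,0)$. Moreover, $(X_m^+,X_m^-)_{m\ge1}$ is a time-homogeneous Markov chain with transition kernel $\mathbf P$ under $\Pi_0$: the same value $\mathbf P_{p,q}^{r,s}$ is obtained when one conditions on any event $\{(X_k^+,X_k^-)=x_k \text{ for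 all } 1\le k\le m\}$ of positive probability with $x_m=(p,q)$. -/

import Mathlib

open scoped ENNReal

noncomputable section

/-! ### Incomplete binary trees and their labels

A (nonempty) incomplete binary tree is a term of `BinaryTree Unit` other than `nil`: every `node`
is a vertex with a left and a right subtree, each of which is possibly empty (`nil`).
Labels: the root has a prescribed label `x`, a left child has the label of its parent minus one, a
right child has the label of its parent plus one. Functions of labelled trees hence take the
label `x` of the root as an argument. -/

namespace IncBinTree

open BinaryTree

/-- All sets of trees are events. -/
instance : MeasurableSpace (BinaryTree Unit) := ⊤

/-- The vector of label increments from a vertex to its children, from left to right, for a vertex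
with left subtree `a` and right subtree `b`. -/
def increments (a b : BinaryTree Unit) : List ℤ :=
  (if a = nil then [] else [-1]) ++ (if b = nil then [] else [1])

/-- The offspring distribution `(1/4) δ₀ + (1/2) δ₁ + (1/4) δ₂`. -/
def offspring (k : ℕ) : ℝ≥0∞ :=
  if k = 0 then 1 / 4 else if k = 1 then 1 / 2 else if k = 2 then 1 / 4 else 0

/-- The displacement distributions: the increment vector of a vertex with one child is uniform on
`{(-1), (1)}`, that of a vertex with two children is `(-1, 1)`, that of a leaf is empty. -/
def displacement (d : List ℤ) : ℝ≥0∞ :=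
  if d = [] then 1 else if d = [-1] ∨ d = [1] then 1 / 2 else if d = [-1, 1] then 1 else 0

/-- The product over all vertices `v` of the probability of the number of children of `v` times the
probability of the vector of increments from `v` to its children. -/
def weight : BinaryTree Unit → ℝ≥0∞
  | nil => 1
  | node _ a b =>
      offspring (increments a b).length * displacement (increments a b) * weight a * weight b

/-- In this model each vertex has a left child with probability `1/2` and, independently, a right
child with probability `1/2`. -/
lemma vertex_factor (a b : BinaryTree Unit) :
    offspring (increments a b).length * displacement (increments a b) = 1 / 4 := by
  have h : (2⁻¹ : ℝ≥0∞) * 2⁻¹ = 4⁻¹ := by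
    rw [← ENNReal.mul_inv (by simp) (by simp)]; norm_num
  by_cases ha : a = nil <;> by_cases hb : b = nil <;>
    simp [increments, offspring, displacement, ha, hb, h]

lemma weight_node (u : Unit) (a b : BinaryTree Unit) :
    weight (node u a b) = 1 / 4 * weight a * weight b := by
  rw [weight, vertex_factor]

/-- A tree with `n` vertices (hence `n - 1` edges) has weight `4⁻ⁿ`. -/
lemma weight_eq (t : BinaryTree Unit) : weight t = (1 / 4) ^ t.numNodes := by
  induction t with
  | nil => simp [weight]
  | node u a b iha ihb => rw [weight_node, iha, ihb, numNodes]; ring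

/-- Finite sets of trees of bounded height, which exhaust all trees. -/
def upTo : ℕ → Finset (BinaryTree Unit)
  | 0 => ∅
  | h + 1 => insert nil ((upTo h ×ˢ upTo h).image fun ab => node () ab.1 ab.2)

lemma upTo_mono {h k : ℕ} (hk : h ≤ k) : upTo h ⊆ upTo k := by
  induction h generalizing k with
  | zero => simp [upTo]
  | succ h ih =>
    obtain ⟨k, rfl⟩ : ∃ j, k = j + 1 := ⟨k - 1, by omega⟩
    have := ih (k := k) (by omega)
    exact Finset.insert_subset_insert _ (Finset.image_subset_image
      (Finset.product_subset_product this this))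

lemma mem_upTo (t : BinaryTree Unit) : ∃ h, t ∈ upTo h := by
  induction t with
  | nil => exact ⟨1, by simp [upTo]⟩
  | node u a b iha ihb =>
    obtain ⟨h, hh⟩ := iha
    obtain ⟨k, hk⟩ := ihb
    refine ⟨max h k + 1, ?_⟩
    simp only [upTo, Finset.mem_insert, Finset.mem_image, Finset.mem_product]
    exact Or.inr ⟨(a, b), ⟨upTo_mono (le_max_left _ _) hh, upTo_mono (le_max_right _ _) hk⟩, rfl⟩

lemma quarter_mul_two_mul_two : (1 / 4 : ℝ≥0∞) * (2 * 2) = 1 := by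
  rw [show (2 * 2 : ℝ≥0∞) = 4 by norm_num, one_div]
  exact ENNReal.inv_mul_cancel (by simp) (by simp)

lemma sum_upTo_le (h : ℕ) : ∑ t ∈ upTo h, weight t ≤ 2 := by
  induction h with
  | zero => simp [upTo]
  | succ h ih =>
    rw [upTo, Finset.sum_insert (by simp), Finset.sum_image (by
      rintro ⟨a, b⟩ _ ⟨c, d⟩ _ hab
      simpa using hab), Finset.sum_product]
    simp only [weight_node, mul_assoc]
    rw [weight]
    simp only [← Finset.mul_sum, ← Finset.sum_mul]
    calc 1 + 1 / 4 * ((∑ t ∈ upTo h, weight t) * ∑ t ∈ upTo h, weight t)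
        ≤ 1 + 1 / 4 * (2 * 2) := by gcongr
      _ = 2 := by rw [quarter_mul_two_mul_two]; norm_num

lemma tsum_weight_le : ∑' t, weight t ≤ 2 := by
  rw [ENNReal.tsum_eq_iSup_sum]
  refine iSup_le fun s => ?_
  choose h hh using mem_upTo
  refine le_trans (Finset.sum_le_sum_of_subset ?_) (sum_upTo_le (s.sup h))
  exact fun t ht => upTo_mono (Finset.le_sup ht) (hh t)

/-- A tree is empty or consists of a root and two subtrees. -/
def treeEquiv : Unit ⊕ (BinaryTree Unit × BinaryTree Unit) ≃ BinaryTree Unit where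
  toFun o := o.elim (fun _ => nil) fun ab => node () ab.1 ab.2
  invFun
    | nil => Sum.inl ()
    | node _ a b => Sum.inr (a, b)
  left_inv o := by cases o <;> rfl
  right_inv t := by cases t <;> rfl

lemma tsum_weight_eq : ∑' t, weight t = 1 + ∑' a, ∑' b, weight (node () a b) := by
  rw [← treeEquiv.tsum_eq, ENNReal.summable.tsum_sum ENNReal.summable, ← ENNReal.tsum_prod]
  simp [treeEquiv, weight]

lemma tsum_weight : ∑' t, weight t = 2 := by
  have h1 := tsum_weight_eq
  simp only [weight_node, mul_assoc, ENNReal.tsum_mul_left, ENNReal.tsum_mul_right] at h1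
  have h2 := tsum_weight_le
  set S := ∑' t, weight t
  have hS : S ≠ ∞ := ne_top_of_le_ne_top (by simp) h2
  have h3 : S.toReal = 1 + 1 / 4 * (S.toReal * S.toReal) := by
    conv_lhs => rw [h1]
    rw [ENNReal.toReal_add (by simp) (by finiteness)]
    simp
  have h4 : S.toReal = 2 := by nlinarith [sq_nonneg (S.toReal - 2)]
  rw [← ENNReal.ofReal_toReal hS, h4]
  simp

lemma tsum_law : ∑' t : BinaryTree Unit, (if t = nil then 0 else weight t) = 1 := by
  have h1 : ∑' t, weight t = weight nil + ∑' t, (if t = nil then 0 else weight t) := by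
    rw [ENNReal.tsum_eq_add_tsum_ite (f := weight) nil]
    congr!
  rw [tsum_weight, weight, show (2 : ℝ≥0∞) = 1 + 1 by norm_num] at h1
  exact ((ENNReal.add_right_inj (by simp)).1 h1).symm

/-- The law of the labelled Galton--Watson tree of the model (for any prescribed label of the
root): the tree is nonempty, and a nonempty tree is charged with its weight. -/
def treeLaw : PMF (BinaryTree Unit) :=
  ⟨fun t => if t = nil then 0 else weight t, tsum_law ▸ ENNReal.summable.hasSum⟩

/-- The number of edges, oriented away from the root, from a vertex labelled `i` to a vertex
labelled `j`, in the tree whose root has label `x`. -/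
def edgeCount (i j : ℤ) : ℤ → BinaryTree Unit → ℕ
  | _, nil => 0
  | x, node _ a b =>
      (if a ≠ nil ∧ x = i ∧ x - 1 = j then 1 else 0) +
      (if b ≠ nil ∧ x = i ∧ x + 1 = j then 1 else 0) +
      edgeCount i j (x - 1) a + edgeCount i j (x + 1) b

/-- The vertical edge profile `(X_m⁺, X_m⁻)` of the tree with root labelled `0`: the numbers of
oriented edges from label `m - 1` to label `m` and from label `m` to label `m - 1`. -/
def profile (m : ℕ) (t : BinaryTree Unit) : ℕ × ℕ :=
  (edgeCount (m - 1) m 0 t, edgeCount m (m - 1) 0 t)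

/-- The state space `(ℕ_{>0} × ℕ) ∪ {(0, 0)}`. -/
def states : Set (ℕ × ℕ) := {x | 0 < x.1} ∪ {(0, 0)}

/-- The truncation at level `l` of the tree with root labelled `x`: all vertices with a strict
ancestor labelled `l` are deleted. -/
def truncate (l : ℤ) : ℤ → BinaryTree Unit → BinaryTree Unit
  | _, nil => nil
  | x, node _ a b =>
      if x = l then node () nil nil
      else node () (truncate l (x - 1) a) (truncate l (x + 1) b)

/-- The number of vertices labelled `l` in the tree with root labelled `x`. -/
def labelCount (l : ℤ) : ℤ → BinaryTree Unit → ℕ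
  | _, nil => 0
  | x, node _ a b =>
      (if x = l then 1 else 0) + labelCount l (x - 1) a + labelCount l (x + 1) b

/-- The law of a positive tree excursion (with root labelled `1`): the truncation at level `0` of
the random tree with root labelled `1`. -/
def excursionLaw : PMF (BinaryTree Unit) := treeLaw.map (truncate 0 1)

/-- The law `ν` of the number of vertices labelled `0` in a positive tree excursion. -/
def nu : PMF ℕ := excursionLaw.map (labelCount 0 1)

/-- The law `f_k` of `S_k = N_1 + ⋯ + N_k`, where the `N_j` are i.i.d. with law `ν`. -/
def walkLaw : ℕ → PMF ℕ
  | 0 => PMF.pure 0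
  | k + 1 => (walkLaw k).bind fun a => nu.map fun n => a + n

/-- `f_k(l) = P(S_k = l)` as a real number. -/
def f (k l : ℕ) : ℝ := (walkLaw k l).toReal

/-- The explicit kernel, equal to `1` by convention from `(0, 0)` to `(0, 0)`. -/
def kernel (p q r s : ℕ) : ℝ :=
  if p = 0 ∧ q = 0 ∧ r = 0 ∧ s = 0 then 1
  else (p : ℝ) * (4 : ℝ) ^ (-(p : ℤ) - (s : ℤ)) / ((p : ℝ) + (s : ℝ)) *
    ((p + s).choose r : ℝ) * ((p + s).choose q : ℝ) * (f r s / f p q)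

end IncBinTree

end

/-! Cut the tree along the edges between labels `m - 1` and `m`. The pieces above are excursions
above `m - 1` started at `m`, with a generating series `U` in the number of edges back to `m - 1`;
the pieces below have series `D` (started at `m - 1`) and `F` (the piece with the root). With `x`,
`y` marking upward and downward crossings, the totals satisfy `T = U(y T')`, `T' = D(x T)`, `T₀ =
F(x T)`. Lagrange inversion (`two_type_lagrange`) gives `p [x^p y^q] T₀ = [U^p]_q · L(p, q)`, where
`L` involves only `F` and `D`. Marks on levels below `m` enter only `L`, those above only `U`. So in
a conditional probability given the profile up to level `m`, the past cancels: this is the Markov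
property.

Without marks, `[U^p]_q = f_p(q)`. To refine by the crossings between `m` and `m + 1`, decompose at
the vertices labelled `m`. There are `p + s` of them, `p` entered from below and `s` from above.
Each has weight `1/4`, a left child for `q` of them and a right child for `r` of them, and the `r`
excursions above `m` return `s` times. One-type Lagrange inversion supplies the factor `p / (p +
s)`, so (`coeff_upSeries_pow`) the refined coefficient is `p/(p+s) 4^(-p-s) C(p+s,q) C(p+s,r)
f_r(s)`. Its quotient by `f_p(q)` is the kernel.

For the law `ν`, weight the first visits to `0` by `z`. The totals `a n` from root label `n` obey `a
(n+1) = (1 + a n)(1 + a (n+2))/4`, `a 0 = z`. The difference of two solutions in `[0,1]` has convex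
absolute value, so `a 1` is determined by `a 0` (`eq_of_recursion`), and an explicit rational
solution gives the formula.

All series have coefficients in `ℝ≥0∞` or in power series over it. Every sum then exists and may be
rearranged; the price is that there is no subtraction, and denominators are cleared by natural
multiples. -/

noncomputable section

open scoped MvPowerSeries.WithPiTopology

/-! ### Semirings in which every family is summable -/

/-- A topological commutative semiring, without additive torsion, in which all families (indexed by
small types) are summable and multiplication distributes over infinite sums. -/
class SumComplete (R : Type) [CommSemiring R] [TopologicalSpace R] : Prop
    extends T3Space R, ContinuousAdd R where
  summable_all : ∀ {ι : Type} (f : ι → R), Summable f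
  tsum_mul : ∀ {ι : Type} (a : R) (f : ι → R), ∑' i, a * f i = a * ∑' i, f i
  nsmul_inj : ∀ {n : ℕ}, n ≠ 0 → ∀ {a b : R}, n • a = n • b → a = b

instance : SumComplete ℝ≥0∞ where
  summable_all _ := ENNReal.summable
  tsum_mul _ _ := ENNReal.tsum_mul_left
  nsmul_inj {n} hn a b h := by
    rw [nsmul_eq_mul, nsmul_eq_mul] at h
    exact (ENNReal.mul_right_inj (by exact_mod_cast hn) (by simp)).1 h

namespace SumComplete

section Basic

variable {R : Type} [CommSemiring R] [TopologicalSpace R] [SumComplete R] {ι κ : Type}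

lemma mul_tsum (a : R) (f : ι → R) : a * ∑' i, f i = ∑' i, a * f i := (tsum_mul a f).symm

lemma tsum_mul' (f : ι → R) (a : R) : (∑' i, f i) * a = ∑' i, f i * a := by
  rw [mul_comm, mul_tsum]
  exact tsum_congr fun i => mul_comm _ _

lemma tsum_swap (f : ι → κ → R) : ∑' i, ∑' k, f i k = ∑' k, ∑' i, f i k :=
  Summable.tsum_comm' (summable_all _) (fun _ => summable_all _) (fun _ => summable_all _)

lemma tsum_pair (f : ι × κ → R) : ∑' p, f p = ∑' i, ∑' k, f (i, k) :=
  Summable.tsum_prod' (summable_all _) fun _ => summable_all _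

lemma tsum_mul_tsum (f : ι → R) (g : κ → R) :
    (∑' i, f i) * ∑' k, g k = ∑' i, ∑' k, f i * g k := by
  rw [tsum_mul']
  exact tsum_congr fun i => mul_tsum _ _

open Finset Finset.HasAntidiagonal in
lemma tsum_antidiagonal (f : ℕ × ℕ → R) :
    ∑' p, f p = ∑' n, ∑ p ∈ antidiagonal n, f p := by
  rw [← HasAntidiagonal.sigmaAntidiagonalEquivProd.tsum_eq,
    Summable.tsum_sigma' (fun _ => summable_all _)
    (summable_all _)]
  refine tsum_congr fun n => ?_
  rw [tsum_fintype, ← sum_coe_sort (antidiagonal n)]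
  rfl

lemma tsum_split (x : ι) (f : ι → R) [DecidableEq ι] :
    ∑' i, f i = f x + ∑' i, if i = x then 0 else f i := by
  have h : ∀ i, f i = (if i = x then f x else 0) + if i = x then 0 else f i := by
    intro i
    by_cases hi : i = x <;> simp [hi]
  rw [tsum_congr h, Summable.tsum_add (summable_all _) (summable_all _), tsum_ite_eq]

end Basic

section PowerSeries

variable {R : Type} [CommSemiring R] [TopologicalSpace R] [SumComplete R] {σ ι : Type}

lemma coeff_tsum (f : ι → MvPowerSeries σ R) (n : σ →₀ ℕ) :
    MvPowerSeries.coeff n (∑' i, f i) = ∑' i, MvPowerSeries.coeff n (f i) :=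
  Summable.map_tsum (MvPowerSeries.WithPiTopology.summable_iff_summable_coeff.2
    fun _ => summable_all _) (MvPowerSeries.coeff n)
    (MvPowerSeries.WithPiTopology.continuous_coeff R n)

instance : SumComplete (MvPowerSeries σ R) where
  toT3Space := inferInstanceAs (T3Space ((σ →₀ ℕ) → R))
  toContinuousAdd := inferInstanceAs (ContinuousAdd ((σ →₀ ℕ) → R))
  summable_all _ := MvPowerSeries.WithPiTopology.summable_iff_summable_coeff.2
    fun _ => summable_all _
  tsum_mul a f := by
    classical
    ext n
    rw [coeff_tsum, MvPowerSeries.coeff_mul]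
    simp only [MvPowerSeries.coeff_mul, coeff_tsum, mul_tsum]
    exact Summable.tsum_finsetSum fun _ _ => summable_all _
  nsmul_inj hn a b h := by
    ext n
    have := congrArg (MvPowerSeries.coeff n) h
    rw [map_nsmul, map_nsmul] at this
    exact nsmul_inj hn this

end PowerSeries

end SumComplete

/-! ### Substitution into power series -/

open SumComplete PowerSeries

lemma PowerSeries.coeff_tsum {R : Type} [CommSemiring R] [TopologicalSpace R] [SumComplete R]
    {ι : Type} (f : ι → PowerSeries R) (n : ℕ) :
    coeff n (∑' i, f i) = ∑' i, coeff n (f i) :=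
  SumComplete.coeff_tsum f _

/-- A ring homomorphism that commutes with infinite sums. -/
def PreservesTsum {R S : Type} [CommSemiring R] [TopologicalSpace R] [CommSemiring S]
    [TopologicalSpace S] (j : R →+* S) : Prop :=
  ∀ {ι : Type} (f : ι → R), j (∑' i, f i) = ∑' i, j (f i)

section Homs

variable {R S Q : Type} [CommSemiring R] [CommSemiring S] [CommSemiring Q]
  [TopologicalSpace Q]

section Eval

variable [SumComplete Q]

/-- Evaluation of a power series at an element of a sum complete semiring. -/
def evalAt (j : R →+* Q) (y : Q) : PowerSeries R →+* Q where
  toFun φ := ∑' b, j (coeff b φ) * y ^ b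
  map_one' := by
    rw [tsum_eq_single 0]
    · simp
    · intro b hb
      simp [coeff_one, hb]
  map_zero' := by simp
  map_add' φ ψ := by
    rw [← Summable.tsum_add (summable_all _) (summable_all _)]
    simp [add_mul]
  map_mul' φ ψ := by
    rw [tsum_mul_tsum, ← tsum_pair (fun p : ℕ × ℕ =>
      j (coeff p.1 φ) * y ^ p.1 * (j (coeff p.2 ψ) * y ^ p.2)), tsum_antidiagonal]
    refine tsum_congr fun n => ?_
    rw [coeff_mul, map_sum, Finset.sum_mul]
    refine Finset.sum_congr rfl fun p hp => ?_
    rw [← Finset.HasAntidiagonal.mem_antidiagonal.1 hp, map_mul, pow_add]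
    ring

lemma evalAt_apply (j : R →+* Q) (y : Q) (φ : PowerSeries R) :
    evalAt j y φ = ∑' b, j (coeff b φ) * y ^ b := rfl

@[simp] lemma evalAt_C (j : R →+* Q) (y : Q) (a : R) : evalAt j y (C a) = j a := by
  rw [evalAt_apply, tsum_eq_single 0]
  · simp
  · intro b hb
    simp [coeff_C, hb]

lemma evalAt_comp_C (j : R →+* Q) (y : Q) : (evalAt j y).comp C = j :=
  RingHom.ext fun a => evalAt_C j y a

@[simp] lemma evalAt_X (j : R →+* Q) (y : Q) : evalAt j y X = y := by
  rw [evalAt_apply, tsum_eq_single 1]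
  · simp
  · intro b hb
    simp [coeff_X, hb]

lemma evalAt_map (j : R →+* S) (k : S →+* Q) (y : Q) (φ : PowerSeries R) :
    evalAt k y (map j φ) = evalAt (k.comp j) y φ := by
  simp [evalAt_apply]

end Eval

variable [TopologicalSpace S]

lemma map_evalAt [SumComplete S] [SumComplete Q] {j : R →+* S} {k : S →+* Q}
    (hk : PreservesTsum k) (y : S) (φ : PowerSeries R) :
    k (evalAt j y φ) = evalAt (k.comp j) (k y) φ := by
  rw [evalAt_apply, evalAt_apply, hk]
  simp

variable [TopologicalSpace R]

lemma PreservesTsum.comp {j : R →+* S} {k : S →+* Q} (hk : PreservesTsum k)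
    (hj : PreservesTsum j) : PreservesTsum (k.comp j) := fun f => by
  simp only [RingHom.comp_apply]
  rw [hj, hk]

variable [SumComplete R] [SumComplete S] [SumComplete Q]

lemma preservesTsum_of_continuous {j : R →+* S} (hj : Continuous j) : PreservesTsum j :=
  fun f => Summable.map_tsum (summable_all f) j hj

lemma preservesTsum_MvC {σ : Type} : PreservesTsum (MvPowerSeries.C (σ := σ) (R := R)) :=
  preservesTsum_of_continuous MvPowerSeries.WithPiTopology.continuous_C

lemma preservesTsum_C : PreservesTsum (C (R := R)) := preservesTsum_MvC

lemma preservesTsum_map {j : R →+* S} (hj : PreservesTsum j) : PreservesTsum (map j) := fun f => by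
  ext n
  rw [coeff_map, PowerSeries.coeff_tsum, PowerSeries.coeff_tsum, hj]
  simp

lemma preservesTsum_evalAt {j : R →+* S} (hj : PreservesTsum j) (y : S) :
    PreservesTsum (evalAt j y) := fun f => by
  simp only [evalAt_apply]
  rw [tsum_swap]
  refine tsum_congr fun b => ?_
  rw [PowerSeries.coeff_tsum, hj, tsum_mul']

end Homs

open Finset.HasAntidiagonal

/-! ### Weighted labelled trees and absorbing levels -/

namespace IncBinTree

open BinaryTree

/-- Weights for labelled trees: `vertex x` for a vertex labelled `x`, and `down x`, `up x` for the
edges from a vertex labelled `x` to a left, respectively right, child. -/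
@[ext]
structure System (R : Type) where
  vertex : ℤ → R
  down : ℤ → R
  up : ℤ → R

namespace System

section Defs

variable {R S : Type}

/-- The system with weights in `S` obtained by applying a function. -/
def map (j : R → S) (P : System R) : System S :=
  ⟨fun x => j (P.vertex x), fun x => j (P.down x), fun x => j (P.up x)⟩

/-- Translation of the labels. -/
def shift (P : System R) (k : ℤ) : System R :=
  ⟨fun x => P.vertex (x + k), fun x => P.down (x + k), fun x => P.up (x + k)⟩

/-- Reflection of the labels. -/
def reflect (P : System R) : System R :=
  ⟨fun x => P.vertex (-x), fun x => P.up (-x), fun x => P.down (-x)⟩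

variable [CommSemiring R] [CommSemiring S]

/-- The system in which vertices labelled `l` have weight `y` and no children. -/
def absorb (P : System R) (l : ℤ) (y : R) : System R :=
  ⟨Function.update P.vertex l y, Function.update P.down l 0, Function.update P.up l 0⟩

/-- The system in which edges from `x` to `x - 1` have weight one. -/
def freeDown (P : System R) (x : ℤ) : System R :=
  ⟨P.vertex, Function.update P.down x 1, P.up⟩

/-- The weight of the tree with root labelled `x`. -/
def weight (P : System R) : ℤ → BinaryTree Unit → R
  | _, nil => 1
  | x, node _ a b =>
      P.vertex x * (if a = nil then 1 else P.down x * weight P (x - 1) a) *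
        (if b = nil then 1 else P.up x * weight P (x + 1) b)

/-- The total weight of all nonempty trees with root labelled `x`. -/
def total [TopologicalSpace R] (P : System R) (x : ℤ) : R :=
  ∑' t : BinaryTree Unit, if t = nil then 0 else P.weight x t

lemma weight_map (P : System R) (j : R →+* S) (x : ℤ) (t : BinaryTree Unit) :
    (P.map j).weight x t = j (P.weight x t) := by
  induction t generalizing x with
  | nil => simp [weight]
  | node u a b iha ihb =>
    simp only [weight, iha, ihb, map_mul]
    split_ifs <;> simp [map]

lemma weight_shift (P : System R) (k x : ℤ) (t : BinaryTree Unit) :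
    (P.shift k).weight x t = P.weight (x + k) t := by
  induction t generalizing x with
  | nil => simp [weight]
  | node u a b iha ihb =>
    rw [weight, weight, iha, ihb, show x - 1 + k = x + k - 1 by ring,
      show x + 1 + k = x + k + 1 by ring]
    rfl

end Defs

/-- The mirror image of a tree. -/
def mirror : BinaryTree Unit → BinaryTree Unit
  | nil => nil
  | node u a b => node u (mirror b) (mirror a)

lemma mirror_mirror (t : BinaryTree Unit) : mirror (mirror t) = t := by
  induction t with
  | nil => rfl
  | node u a b iha ihb => simp [mirror, iha, ihb]

lemma mirror_eq_nil {t : BinaryTree Unit} : mirror t = nil ↔ t = nil := by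
  cases t <;> simp [mirror]

/-- Taking mirror images as a permutation of all trees. -/
def mirrorEquiv : BinaryTree Unit ≃ BinaryTree Unit :=
  ⟨mirror, mirror, mirror_mirror, mirror_mirror⟩

section Weight

variable {R : Type} [CommSemiring R]

lemma weight_reflect (P : System R) (x : ℤ) (t : BinaryTree Unit) :
    P.reflect.weight (-x) t = P.weight x (mirror t) := by
  induction t generalizing x with
  | nil => simp [weight, mirror]
  | node u a b iha ihb =>
    simp only [weight, mirror, mirror_eq_nil, ← iha, ← ihb, reflect, neg_neg,
      show -x - 1 = -(x + 1) by ring, show -x + 1 = -(x - 1) by ring]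
    ring

/-- Only the weights above `l` matter for a tree that starts above `l` and stops there. -/
lemma weight_absorb_congr {P Q : System R} {l : ℤ} (y : R)
    (hv : ∀ z, l < z → P.vertex z = Q.vertex z) (hd : ∀ z, l < z → P.down z = Q.down z)
    (hu : ∀ z, l < z → P.up z = Q.up z) {x : ℤ} (hx : l ≤ x) (t : BinaryTree Unit) :
    (P.absorb l y).weight x t = (Q.absorb l y).weight x t := by
  induction t generalizing x with
  | nil => simp [weight]
  | node u a b iha ihb =>
    rcases hx.eq_or_lt with rfl | hlt
    · simp [weight, absorb]
    · rw [weight, weight, iha (by omega), ihb (by omega)]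
      simp [absorb, hlt.ne', hv x hlt, hd x hlt, hu x hlt]

/-- The weight of the edges into an absorbing level can be moved to that level. -/
lemma weight_absorb_freeDown (P : System R) {l : ℤ} (y : R) {x : ℤ} (hx : l ≤ x)
    (t : BinaryTree Unit) :
    ((P.freeDown (l + 1)).absorb l (P.down (l + 1) * y)).weight x t =
      if x = l ∧ t ≠ nil then P.down (l + 1) * (P.absorb l y).weight x t
      else (P.absorb l y).weight x t := by
  induction t generalizing x with
  | nil => simp [weight]
  | node u a b iha ihb =>
    rcases hx.eq_or_lt with rfl | hlt
    · simp [weight, absorb]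
    · rw [if_neg (by omega), weight, weight, iha (by omega), ihb (by omega),
        if_neg (by omega : ¬ (x + 1 = l ∧ b ≠ nil))]
      by_cases ha : a = nil
      · simp [ha, absorb, freeDown, hlt.ne']
      · by_cases hl : x = l + 1
        · subst hl
          simp [ha, absorb, freeDown]
        · rw [if_neg (by omega : ¬ (x - 1 = l ∧ a ≠ nil))]
          simp [ha, absorb, freeDown, hlt.ne', hl]

end Weight

/-! ### Total weights and the branching property -/

section Total

variable {R S : Type} [CommSemiring R] [TopologicalSpace R] [CommSemiring S] [TopologicalSpace S]

lemma total_map (P : System R) {j : R →+* S} (hj : PreservesTsum j) (x : ℤ) :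
    (P.map j).total x = j (P.total x) := by
  rw [total, total, hj]
  refine tsum_congr fun t => ?_
  rw [weight_map]
  split_ifs <;> simp

lemma total_shift (P : System R) (k x : ℤ) : (P.shift k).total x = P.total (x + k) := by
  simp only [total, weight_shift]

lemma total_reflect (P : System R) (x : ℤ) : P.reflect.total (-x) = P.total x := by
  rw [total, total, ← mirrorEquiv.tsum_eq]
  refine tsum_congr fun t => ?_
  rw [weight_reflect]
  simp [mirrorEquiv, mirror_mirror, mirror_eq_nil]

lemma total_absorb_congr {P Q : System R} {l : ℤ} (y : R)
    (hv : ∀ z, l < z → P.vertex z = Q.vertex z) (hd : ∀ z, l < z → P.down z = Q.down z)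
    (hu : ∀ z, l < z → P.up z = Q.up z) {x : ℤ} (hx : l ≤ x) :
    (P.absorb l y).total x = (Q.absorb l y).total x := by
  simp only [total, weight_absorb_congr y hv hd hu hx]

lemma total_absorb_freeDown (P : System R) {l x : ℤ} (y : R) (hx : l < x) :
    ((P.freeDown (l + 1)).absorb l (P.down (l + 1) * y)).total x = (P.absorb l y).total x := by
  simp only [total, weight_absorb_freeDown P y hx.le, hx.ne', false_and, if_false]

variable [SumComplete R] [SumComplete S]

lemma tsum_tree (f : BinaryTree Unit → R) :
    ∑' t, f t = f nil + ∑' a, ∑' b, f (node () a b) := by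
  rw [← treeEquiv.tsum_eq, (summable_all _).tsum_sum (summable_all _), tsum_pair]
  simp [treeEquiv]

lemma tsum_child (f : BinaryTree Unit → R) (c : R) :
    ∑' t, (if t = nil then 1 else c * f t) = 1 + c * ∑' t, if t = nil then 0 else f t := by
  classical
  rw [tsum_split nil, mul_tsum]
  simp only [if_true]
  congr 1
  refine tsum_congr fun t => ?_
  split_ifs <;> simp

lemma total_eq (P : System R) (x : ℤ) :
    P.total x = P.vertex x * (1 + P.down x * P.total (x - 1)) *
      (1 + P.up x * P.total (x + 1)) := by
  rw [total, tsum_tree, if_pos rfl, zero_add]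
  simp only [reduceCtorEq, if_false, weight]
  rw [total, total, ← tsum_child, ← tsum_child, mul_assoc, tsum_mul_tsum, mul_tsum]
  simp only [mul_tsum, mul_assoc]

lemma total_absorb_self (P : System R) (l : ℤ) (y : R) : (P.absorb l y).total l = y := by
  rw [total_eq]
  simp [absorb]

lemma truncate_eq_nil {l x : ℤ} {t : BinaryTree Unit} : truncate l x t = nil ↔ t = nil := by
  cases t with
  | nil => simp [truncate]
  | node u a b =>
    rw [truncate]
    split_ifs <;> simp

/-- The total weight of the trees with a given truncation at level `l`. -/
lemma tsum_truncate_eq (P : System R) (l x : ℤ) (t' : BinaryTree Unit) :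
    ∑' t, (if truncate l x t = t' then P.weight x t else 0) =
      (P.absorb l (P.total l)).weight x t' := by
  induction t' generalizing x with
  | nil => simp [truncate_eq_nil, weight]
  | node u a' b' iha ihb =>
    rw [tsum_tree, truncate, if_neg (by simp), zero_add]
    by_cases hx : x = l
    · subst hx
      by_cases hab : a' = nil ∧ b' = nil
      · obtain ⟨rfl, rfl⟩ := hab
        have h1 : P.total x = ∑' a, ∑' b, P.weight x (node () a b) := by
          rw [total, tsum_tree]
          simp
        have h2 : (P.absorb x (P.total x)).weight x (node u nil nil) = P.total x := by
          simp [weight, absorb]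
        rw [h2, h1]
        simp [truncate]
      · rw [not_and_or] at hab
        have h1 : ∀ a b, truncate x x (node () a b) ≠ node u a' b' := by
          intro a b h
          rw [truncate, if_pos rfl] at h
          simp only [BinaryTree.node.injEq] at h
          rcases hab with h' | h'
          · exact h' h.2.1.symm
          · exact h' h.2.2.symm
        simp only [h1, if_false, tsum_zero, weight, absorb, Function.update_self, zero_mul]
        rcases hab with h' | h' <;> simp [h']
    -- An empty subtree is the only one with empty truncation, so the induction hypothesis passes to
    -- the factor of a possibly missing child.
    · have key : ∀ (c : R) (y : ℤ) (s : BinaryTree Unit),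
          ∑' t, (if truncate l y t = s then P.weight y t else 0) =
            (P.absorb l (P.total l)).weight y s →
          ∑' t, (if truncate l y t = s then (if t = nil then 1 else c * P.weight y t) else 0) =
            if s = nil then 1 else c * (P.absorb l (P.total l)).weight y s := by
        intro c y s hs
        by_cases hn : s = nil
        · subst hn
          rw [if_pos rfl, tsum_eq_single nil]
          · simp [truncate]
          · intro t ht
            simp [truncate_eq_nil, ht]
        · rw [if_neg hn, ← hs, mul_tsum]
          refine tsum_congr fun t => ?_
          by_cases ht : truncate l y t = s
          · have : t ≠ nil := fun h => hn (by rw [← ht, h, truncate])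
            simp [ht, this]
          · simp [ht]
      have h2 : (P.absorb l (P.total l)).weight x (node u a' b') =
          P.vertex x * (if a' = nil then 1 else P.down x *
            (P.absorb l (P.total l)).weight (x - 1) a') *
          (if b' = nil then 1 else P.up x * (P.absorb l (P.total l)).weight (x + 1) b') := by
        rw [weight]
        simp [absorb, hx]
      rw [h2, ← key _ _ _ (iha _), ← key _ _ _ (ihb _), mul_assoc, tsum_mul_tsum, mul_tsum]
      refine tsum_congr fun a => ?_
      rw [mul_tsum]
      refine tsum_congr fun b => ?_
      rw [truncate, if_neg hx, weight]
      by_cases h3 : truncate l (x - 1) a = a' <;> by_cases h4 : truncate l (x + 1) b = b' <;>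
        simp [h3, h4, mul_assoc]

/-- The branching property at the vertices labelled `l` without strict ancestors labelled `l`. -/
lemma total_absorb_total (P : System R) (l x : ℤ) :
    (P.absorb l (P.total l)).total x = P.total x := by
  have h0 : (P.absorb l (P.total l)).total x = ∑' t', if t' = nil then 0 else
      ∑' t, if truncate l x t = t' then P.weight x t else 0 :=
    tsum_congr fun t' => by rw [tsum_truncate_eq]
  have : ∀ t', (if t' = nil then 0 else
      ∑' t, if truncate l x t = t' then P.weight x t else 0) =
      ∑' t, if t' = truncate l x t then (if t = nil then 0 else P.weight x t) else 0 := by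
    intro t'
    split_ifs with h
    · subst h
      symm
      refine (tsum_congr fun t => ?_).trans tsum_zero
      by_cases ht : t = nil
      · simp [ht]
      · rw [if_neg]
        exact fun h' => ht (truncate_eq_nil.1 h'.symm)
    · refine tsum_congr fun t => ?_
      by_cases ht : t = nil
      · subst ht
        simp [truncate, Ne.symm h]
      · simp [ht, eq_comm]
  rw [h0, tsum_congr this, tsum_swap]
  exact tsum_congr fun t => tsum_ite_eq _ _

/-- The generating series, in the number of vertices in the absorbing level `l`, of the trees that
start at `x` and are stopped at `l`; edges from `l + 1` to `l` carry no weight. -/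
def upSeries (P : System R) (l x : ℤ) : PowerSeries R :=
  (((P.map C).freeDown (l + 1)).absorb l X).total x

/-- The analogue of `upSeries` for an absorbing level above the starting point. -/
def downSeries (P : System R) (l x : ℤ) : PowerSeries R := upSeries P.reflect (-l) (-x)

/-- By the branching property, each vertex at the absorbing level carries an independent tree of
total weight `Q.total l`; the edge leading to it is included in the substituted value. So only
weights above `l` have to agree, and those of the edges from `l + 1` to `l` are free, which is why
`hd` starts above `l + 1`. -/
lemma evalAt_upSeries {P : System R} {j : R →+* S} (hj : PreservesTsum j) {Q : System S} {l x : ℤ}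
    (hx : l < x) (hv : ∀ z, l < z → Q.vertex z = j (P.vertex z))
    (hd : ∀ z, l + 1 < z → Q.down z = j (P.down z)) (hu : ∀ z, l < z → Q.up z = j (P.up z)) :
    evalAt j (Q.down (l + 1) * Q.total l) (upSeries P l x) = Q.total x := by
  rw [← total_absorb_total Q l x, ← total_absorb_freeDown Q _ hx, upSeries,
    ← total_map _ (preservesTsum_evalAt hj _)]
  set w := Q.down (l + 1) * Q.total l
  have : (((P.map C).freeDown (l + 1)).absorb l X).map (evalAt j w) =
      ((P.map j).freeDown (l + 1)).absorb l w := by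
    ext z <;> by_cases h1 : z = l <;> by_cases h2 : z = l + 1 <;>
      simp [map, absorb, freeDown, Function.update_apply, h1, h2]
  rw [this]
  refine total_absorb_congr w (fun z hz => (hv z hz).symm) (fun z hz => ?_)
    (fun z hz => (hu z hz).symm) hx.le
  by_cases h2 : z = l + 1
  · simp [freeDown, h2]
  · simp [freeDown, h2, map, hd z (by omega)]

lemma evalAt_downSeries {P : System R} {j : R →+* S} (hj : PreservesTsum j) {Q : System S}
    {l x : ℤ} (hx : x < l) (hv : ∀ z, z < l → Q.vertex z = j (P.vertex z))
    (hd : ∀ z, z < l → Q.down z = j (P.down z)) (hu : ∀ z, z < l - 1 → Q.up z = j (P.up z)) :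
    evalAt j (Q.up (l - 1) * Q.total l) (downSeries P l x) = Q.total x := by
  rw [← total_reflect Q l, ← total_reflect Q x, downSeries,
    ← evalAt_upSeries hj (P := P.reflect) (Q := Q.reflect) (l := -l) (x := -x) (by omega)]
  · change evalAt j (Q.up (l - 1) * _) _ = evalAt j (Q.up (-(-l + 1)) * _) _
    rw [show -(-l + 1) = l - 1 by ring]
  · exact fun z hz => hv _ (by omega)
  · exact fun z hz => hu _ (by omega)
  · exact fun z hz => hd _ (by omega)

end Total

end System

end IncBinTree

/-! ### Lagrange inversion over semirings -/

namespace PowerSeries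

section Algebra

variable {A : Type} [CommSemiring A]

/-- `n ∑ i [φ^k]_i [φ^(n-k)]_(d-i) = k d [φ^n]_d`. -/
lemma sum_antidiagonal_mul_coeff_pow (φ : PowerSeries A) (k l d : ℕ) :
    (k + l) • ∑ p ∈ antidiagonal d, p.1 • (coeff p.1 (φ ^ k) * coeff p.2 (φ ^ l)) =
      (k * d) • coeff d (φ ^ (k + l)) := by
  -- The operator `X d/dX` multiplies the `n`-th coefficient by `n`; the identity is the `d`-th
  -- coefficient of `(k + l) X (φ^k)' φ^l = k X (φ^(k+l))'`.
  have hD : ∀ (ψ : PowerSeries A) n, coeff n (X * derivative A ψ) = n • coeff n ψ := by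
    intro ψ n
    cases n with
    | zero => simp
    | succ n => rw [coeff_succ_X_mul, coeff_derivative, nsmul_eq_mul, mul_comm]; push_cast; rfl
  have h1 : ∑ p ∈ antidiagonal d, p.1 • (coeff p.1 (φ ^ k) * coeff p.2 (φ ^ l)) =
      coeff d (X * derivative A (φ ^ k) * φ ^ l) := by
    rw [coeff_mul]
    exact Finset.sum_congr rfl fun p _ => by rw [hD, smul_mul_assoc]
  have h2 : (k + l) • (X * derivative A (φ ^ k) * φ ^ l) =
      k • (X * derivative A (φ ^ (k + l))) := by
    rw [derivative_pow, derivative_pow]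
    cases k with
    | zero => simp
    | succ k =>
      rw [nsmul_eq_mul, nsmul_eq_mul, show k + 1 + l - 1 = k + l by omega,
        show k + 1 - 1 = k by omega, pow_add]
      ring
  rw [h1, ← map_nsmul, h2, map_nsmul, hD, smul_smul]

end Algebra

section Complete

variable {A : Type} [CommSemiring A] [TopologicalSpace A] [SumComplete A]

/-- Since `(X E)^b` has no terms of degree below `b`, the infinite substitution is a finite sum in
each degree. -/
lemma coeff_evalAt_C_X_mul (F E : PowerSeries A) (n : ℕ) :
    coeff n (evalAt C (X * E) F) =
      ∑ p ∈ antidiagonal n, coeff p.1 F * coeff p.2 (E ^ p.1) := by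
  rw [evalAt_apply, coeff_tsum]
  simp only [coeff_C_mul, mul_pow, coeff_X_pow_mul']
  rw [tsum_eq_sum (s := Finset.range (n + 1)), Finset.Nat.sum_antidiagonal_eq_sum_range_succ
    (fun i j => coeff i F * coeff j (E ^ i))]
  · refine Finset.sum_congr rfl fun b hb => ?_
    rw [if_pos (by simpa [Nat.lt_succ_iff] using hb)]
  · intro b hb
    rw [if_neg (by simpa [Nat.lt_succ_iff] using hb), mul_zero]

/-- Lagrange inversion. -/
theorem lagrange_inversion {E φ : PowerSeries A} (h : E = evalAt C (X * E) φ) (p s : ℕ) :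
    (p + s) • coeff s (E ^ p) = p • coeff s (φ ^ (p + s)) := by
  have hrec : ∀ p s, coeff s (E ^ p) =
      ∑ i ∈ antidiagonal s, coeff i.1 (φ ^ p) * coeff i.2 (E ^ i.1) := by
    intro p s
    conv_lhs => rw [h, ← map_pow, coeff_evalAt_C_X_mul]
  induction s using Nat.strong_induction_on generalizing p with
  | _ s ih =>
    rcases Nat.eq_zero_or_pos p with rfl | hp
    · rcases Nat.eq_zero_or_pos s with rfl | hs
      · simp
      · simp [coeff_one, hs.ne']
    rcases Nat.eq_zero_or_pos s with rfl | hs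
    · rw [hrec]
      simp
    -- After multiplication by `s = i.1 + i.2`, the induction hypothesis turns the coefficients of
    -- `E^(i.1)` in `hrec` into those of `φ^s`, and `sum_antidiagonal_mul_coeff_pow` evaluates the
    -- sum.
    · refine nsmul_inj hs.ne' ?_
      have h1 : s • coeff s (E ^ p) =
          ∑ i ∈ antidiagonal s, i.1 • (coeff i.1 (φ ^ p) * coeff i.2 (φ ^ s)) := by
        rw [hrec, Finset.smul_sum]
        refine Finset.sum_congr rfl fun i hi => ?_
        have hi' := Finset.HasAntidiagonal.mem_antidiagonal.1 hi
        -- For `i.1 = 0` one has `i.2 = s`, out of reach of the induction, but `E^0 = 1` has no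
        -- coefficient there.
        rcases Nat.eq_zero_or_pos i.1 with h0 | h0
        · have : i.2 ≠ 0 := by omega
          simp [h0, coeff_one, this]
        · have := ih i.2 (by omega) i.1
          rw [hi'] at this
          rw [← mul_smul_comm, this, mul_smul_comm]
      rw [smul_comm, h1, sum_antidiagonal_mul_coeff_pow, smul_smul, mul_comm]

lemma lagrange_inversion_comp {E φ : PowerSeries A} (h : E = evalAt C (X * E) φ)
    (F : PowerSeries A) (n : ℕ) :
    n • coeff n (evalAt C (X * E) F) =
      ∑ p ∈ antidiagonal n, p.1 • (coeff p.1 F * coeff p.2 (φ ^ n)) := by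
  rw [coeff_evalAt_C_X_mul, Finset.smul_sum]
  refine Finset.sum_congr rfl fun i hi => ?_
  have := lagrange_inversion h i.1 i.2
  rw [Finset.HasAntidiagonal.mem_antidiagonal.1 hi] at this
  rw [← mul_smul_comm, this, mul_smul_comm]

/-- The distribution of the total sizes in a two-type branching structure. -/
theorem two_type_lagrange {U D F : PowerSeries A} {T T' T₀ : PowerSeries (PowerSeries A)}
    (hT : T = evalAt (C.comp C) (C X * T') U) (hT' : T' = evalAt (C.comp C) (X * T) D)
    (hT₀ : T₀ = evalAt (C.comp C) (X * T) F) (p q : ℕ) :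
    p • coeff q (coeff p T₀) = coeff q (U ^ p) *
      ∑ i ∈ antidiagonal p, i.1 • (coeff i.1 F * coeff i.2 (D ^ q)) := by
  -- Eliminating `T'` leaves the one-type equation `T = φ(x T)` with `φ(x) = U(y D(x))`.
  set φ : PowerSeries (PowerSeries A) := evalAt (C.comp C) (C X * map C D) U with hφ
  have hE : T = evalAt C (X * T) φ := by
    conv_lhs => rw [hT, hT']
    rw [hφ, map_evalAt (preservesTsum_evalAt preservesTsum_C _), ← RingHom.comp_assoc,
      evalAt_comp_C, map_mul, evalAt_C, evalAt_map]
  -- In `φ^p = (U^p)(y D(x))` the power `y^q` singles out the `q`-th term.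
  have hφp : ∀ s, coeff q (coeff s (φ ^ p)) = coeff q (U ^ p) * coeff s (D ^ q) := by
    intro s
    rw [hφ, ← map_pow, evalAt_apply, coeff_tsum, coeff_tsum, tsum_eq_single q]
    · rw [RingHom.comp_apply, coeff_C_mul, coeff_C_mul, mul_pow, ← map_pow, coeff_C_mul,
        ← map_pow, coeff_map, mul_comm (X ^ q) _, coeff_C_mul]
      simp
    · intro b hb
      rw [RingHom.comp_apply, coeff_C_mul, coeff_C_mul, mul_pow, ← map_pow, coeff_C_mul,
        ← map_pow, coeff_map, mul_comm (X ^ b) _, coeff_C_mul, coeff_X_pow, if_neg hb.symm]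
      simp
  rw [hT₀, ← evalAt_map, ← map_nsmul, lagrange_inversion_comp hE, map_sum, Finset.mul_sum]
  refine Finset.sum_congr rfl fun i _ => ?_
  rw [map_nsmul, coeff_map, coeff_C_mul, hφp]
  rw [mul_left_comm, mul_smul_comm]

end Complete

end PowerSeries

/-! ### Exchange of variables -/

namespace PowerSeries

lemma coeff_one_add_X_pow {A : Type} [CommSemiring A] (n k : ℕ) :
    coeff k ((1 + X : PowerSeries A) ^ n) = (n.choose k : A) := by
  have := Polynomial.coeff_one_add_X_pow A n k
  rw [← this, ← Polynomial.coeff_coe]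
  simp

/-- Exchange of the two variables of an iterated power series. -/
def swap {A : Type} [CommSemiring A] :
    PowerSeries (PowerSeries A) →+* PowerSeries (PowerSeries A) where
  toFun f := mk fun i => mk fun j => coeff i (coeff j f)
  map_one' := by
    ext i j
    by_cases hi : i = 0 <;> by_cases hj : j = 0 <;> simp [coeff_one, hi, hj]
  map_zero' := by ext; simp
  map_add' f g := by ext; simp
  map_mul' f g := by
    ext i j
    simp only [coeff_mk, coeff_mul, map_sum]
    exact Finset.sum_comm

section Swap

variable {A : Type} [CommSemiring A]

@[simp] lemma coeff_coeff_swap (f : PowerSeries (PowerSeries A)) (i j : ℕ) :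
    coeff j (coeff i (swap f)) = coeff i (coeff j f) := by simp [swap]

@[simp] lemma swap_C_C (a : A) : swap (C (C a)) = C (C a) := by
  ext i j
  rw [coeff_coeff_swap]
  by_cases hi : i = 0 <;> by_cases hj : j = 0 <;> simp [coeff_C, hi, hj]

@[simp] lemma swap_X : swap (X : PowerSeries (PowerSeries A)) = C X := by
  ext i j
  rw [coeff_coeff_swap]
  by_cases hi : i = 0 <;> by_cases hj : j = 1 <;> simp [coeff_C, coeff_X, coeff_one, hi, hj]

@[simp] lemma swap_C_X : swap (C X : PowerSeries (PowerSeries A)) = X := by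
  ext i j
  rw [coeff_coeff_swap]
  by_cases hi : i = 1 <;> by_cases hj : j = 0 <;> simp [coeff_C, coeff_X, coeff_one, hi, hj]

lemma preservesTsum_swap [TopologicalSpace A] [SumComplete A] :
    PreservesTsum (swap (A := A)) := fun f => by
  ext i j
  simp only [coeff_coeff_swap, coeff_tsum]

end Swap

end PowerSeries

/-! ### Excursions above a level, refined by the crossings one level higher -/

namespace IncBinTree

open IncBinTree.System

/-- The unmarked system of the model. -/
def baseSystem : System ℝ≥0∞ := ⟨fun _ => 1 / 4, fun _ => 1, fun _ => 1⟩

/-- The generating series of the number of vertices labelled `0` in a positive excursion. -/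
def excursionSeries : PowerSeries ℝ≥0∞ := baseSystem.upSeries 0 1

section

variable {Λ : Type} [CommSemiring Λ] [TopologicalSpace Λ] [SumComplete Λ]

/-- Excursions above `l` with no marks on the edges above level `l + 1`. -/
lemma upSeries_eq_map_excursionSeries {j : ℝ≥0∞ →+* Λ} (hj : PreservesTsum j) {P : System Λ} {l : ℤ}
    (hv : ∀ z, l < z → P.vertex z = j (1 / 4)) (hd : ∀ z, l + 1 < z → P.down z = 1)
    (hu : ∀ z, l < z → P.up z = 1) :
    P.upSeries l (l + 1) = map j excursionSeries := by
  rw [excursionSeries, upSeries, upSeries, ← total_map _ (preservesTsum_map hj),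
    show ((((P.map C).freeDown (l + 1)).absorb l X).total (l + 1)) =
      ((((P.map C).freeDown (l + 1)).absorb l X).shift l).total 1 by
      rw [total_shift, add_comm]]
  have : (((P.map C).freeDown (l + 1)).absorb l X).shift l =
      ((((P.shift l).map C).freeDown 1).absorb 0 X) := by
    ext z <;> by_cases h1 : z = 0 <;> by_cases h2 : z = 1 <;>
      simp [System.map, shift, absorb, freeDown, Function.update_apply, h1, h2, add_comm]
  have h' : ((((baseSystem.map C).freeDown (0 + 1)).absorb 0 X).map (PowerSeries.map j)) =
      ((((baseSystem.map j).map C).freeDown 1).absorb 0 X) := by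
    ext z <;> by_cases h1 : z = 0 <;> by_cases h2 : z = 1 <;>
      simp [System.map, absorb, freeDown, Function.update_apply, h1, h2]
  rw [this, h']
  refine total_absorb_congr X (fun z hz => ?_) (fun z hz => ?_) (fun z hz => ?_) (by norm_num)
  · simp [freeDown, System.map, shift, baseSystem, hv (z + l) (by omega)]
  · by_cases h1 : z = 1
    · simp [freeDown, h1]
    · simp [freeDown, System.map, shift, baseSystem, hd (z + l) (by omega), h1]
  · simp [freeDown, System.map, shift, baseSystem, hu (z + l) (by omega)]

/-- The joint law of the numbers of edges below and above level `l + 1` in excursions above `l`;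
the inner variable marks edges from `l + 1` to `l + 2`, the outer one edges from `l + 2` to
`l + 1`. -/
theorem coeff_upSeries_pow {j : ℝ≥0∞ →+* Λ} (hj : PreservesTsum j)
    {P : System (PowerSeries (PowerSeries Λ))} {l : ℤ}
    (hv : ∀ z, l < z → P.vertex z = C (C (j (1 / 4)))) (hd₁ : P.down (l + 2) = X)
    (hd : ∀ z, l + 2 < z → P.down z = 1) (hu₁ : P.up (l + 1) = C X)
    (hu : ∀ z, l + 1 < z → P.up z = 1) (p q r s : ℕ) :
    (p + s) • coeff r (coeff s (coeff q (P.upSeries l (l + 1) ^ p))) =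
      p • j ((1 / 4) ^ (p + s) * (p + s).choose q * (p + s).choose r *
        coeff s (excursionSeries ^ r)) := by
  -- In `P.upSeries` the outermost variable counts the vertices at `l`; Lagrange inversion needs the
  -- mark of the edges from `l + 2` to `l + 1` outermost.
  set Q := (((P.map C).freeDown (l + 1)).absorb l X).map swap with hQ
  set E := swap (P.upSeries l (l + 1)) with hE
  have hEQ : E = Q.total (l + 1) := by
    rw [hE, upSeries, ← total_map _ preservesTsum_swap]
  have hQl : Q.total l = C X := by
    rw [hQ, total_map _ preservesTsum_swap, total_absorb_self, swap_X]
  set k : ℝ≥0∞ →+* PowerSeries (PowerSeries Λ) := C.comp (C.comp j) with hk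
  have hkt : PreservesTsum k := preservesTsum_C.comp (preservesTsum_C.comp hj)
  -- Above `l + 1` the tree is an unmarked excursion; each return to `l + 1` uses an edge marked `X`
  -- and starts a new copy of `E`.
  have hQu : Q.total (l + 2) = evalAt (C.comp k) (X * E) excursionSeries := by
    have h1 := evalAt_upSeries (preservesTsum_C.comp hkt) (P := baseSystem)
      (Q := Q.shift (l + 1)) (l := 0) (x := 1) (by norm_num) ?_ ?_ ?_
    · rw [total_shift, total_shift, zero_add, zero_add, ← hEQ,
        show (1 : ℤ) + (l + 1) = l + 2 by ring] at h1
      rw [← h1, excursionSeries]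
      congr 3
      simp [hQ, System.map, shift, absorb, freeDown, Function.update_apply,
        show 1 + (l + 1) = l + 2 by ring, hd₁]
    · intro z hz
      simp [hQ, System.map, shift, absorb, freeDown, Function.update_apply,
        show ¬ z + (l + 1) = l by omega, hv (z + (l + 1)) (by omega), hk, baseSystem]
    · intro z hz
      simp [hQ, System.map, shift, absorb, freeDown, Function.update_apply,
        show ¬ z + (l + 1) = l by omega, hd (z + (l + 1)) (by omega), baseSystem,
        show z ≠ 0 by omega]
    · intro z hz
      simp [hQ, System.map, shift, absorb, freeDown, Function.update_apply,
        show ¬ z + (l + 1) = l by omega, hu (z + (l + 1)) (by omega), baseSystem]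
  -- The root decomposition at `l + 1`: vertex weight, optional left child in the absorbing level,
  -- optional right child starting an excursion above `l + 1`. The exponent `p + s` in the inversion
  -- counts the vertices labelled `l + 1`.
  set φ : PowerSeries (PowerSeries (PowerSeries Λ)) :=
    C (k (1 / 4)) * C (1 + X) * (1 + C (C X) * PowerSeries.map k excursionSeries) with hφ
  have hL : E = evalAt C (X * E) φ := by
    conv_lhs => rw [hEQ, total_eq, show l + 1 - 1 = l by ring, show l + 1 + 1 = l + 2 by ring,
      hQl, hQu]
    rw [hφ]
    simp only [map_mul, map_add, map_one, evalAt_C, evalAt_map]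
    simp [hQ, System.map, absorb, freeDown, Function.update_apply, hv (l + 1) (by omega), hu₁, hk]
  have hcoeff : coeff r (coeff s (coeff q (P.upSeries l (l + 1) ^ p))) =
      coeff r (coeff q (coeff s (E ^ p))) := by
    rw [hE, ← map_pow, coeff_coeff_swap]
  rw [hcoeff, ← map_nsmul, ← map_nsmul, lagrange_inversion hL, map_nsmul, map_nsmul]
  congr 1
  have h2 : coeff s (φ ^ (p + s)) = (1 + X) ^ (p + s) * C (C (j ((1 / 4) ^ (p + s))) *
      ∑ i ∈ Finset.range (p + s + 1),
        X ^ i * C (j (coeff s (excursionSeries ^ i) * (p + s).choose i))) := by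
    rw [hφ, mul_pow, mul_pow, ← map_pow C (k _), ← map_pow C (1 + X), mul_assoc, coeff_C_mul,
      coeff_C_mul, add_comm 1 (C (C X) * _), add_pow (C (C X) * _) 1, map_sum, map_mul (C : _ →+* _),
      map_sum, Finset.mul_sum,
      Finset.mul_sum, Finset.mul_sum, Finset.mul_sum]
    refine Finset.sum_congr rfl fun i _ => ?_
    rw [one_pow, mul_one, mul_pow, ← map_pow (PowerSeries.map k), ← map_pow C, mul_assoc,
      coeff_C_mul, show ((p + s).choose i : PowerSeries (PowerSeries (PowerSeries Λ))) =
        C ((p + s).choose i : PowerSeries (PowerSeries Λ)) by simp, coeff_mul_C, coeff_map]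
    simp only [hk, RingHom.comp_apply, map_mul, map_pow, map_natCast]
    ring
  rw [h2, coeff_mul_C, coeff_one_add_X_pow,
    show ((p + s).choose q : PowerSeries Λ) = C (j ((p + s).choose q : ℝ≥0∞)) by simp, coeff_C_mul,
    coeff_C_mul, map_sum]
  simp only [coeff_mul_C, coeff_X_pow, ite_mul, one_mul, zero_mul]
  rw [Finset.sum_ite_eq]
  by_cases hr : r ≤ p + s
  · rw [if_pos (by simpa [Nat.lt_succ_iff] using hr)]
    simp only [map_mul]
    ring
  · rw [if_neg (by simpa [Nat.lt_succ_iff] using hr), Nat.choose_eq_zero_of_lt (not_le.1 hr)]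
    simp

end

end IncBinTree

/-! ### Joint law of the profile at several levels -/

namespace IncBinTree

open BinaryTree

lemma treeLaw_nil : treeLaw nil = 0 := by
  change (if (nil : BinaryTree Unit) = nil then (0 : ℝ≥0∞) else weight nil) = 0
  rw [if_pos rfl]

lemma treeLaw_of_ne_nil {t : BinaryTree Unit} (ht : t ≠ nil) : treeLaw t = weight t := if_neg ht

lemma treeLaw_apply (A : Set (BinaryTree Unit)) :
    treeLaw.toMeasure A = ∑' t, open Classical in if t ∈ A then treeLaw t else 0 := by
  classical
  rw [PMF.toMeasure_apply _ MeasurableSpace.measurableSet_top]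
  exact tsum_congr fun t => by rw [Set.indicator_apply]

/-- The system of the model with marks `d z` and `u z` on the edges from `z` to `z - 1`,
respectively from `z - 1` to `z`. -/
def markedSystem {R : Type} (c : R) (d u : ℤ → R) : System R := ⟨fun _ => c, d, fun x => u (x + 1)⟩

lemma weight_markedSystem {R : Type} [CommSemiring R] (j : ℝ≥0∞ →+* R) {d u : ℤ → R}
    (K : Finset ℤ) (hd : ∀ z ∉ K, d z = 1) (hu : ∀ z ∉ K, u z = 1) (x : ℤ) (t : BinaryTree Unit) :
    (markedSystem (j (1 / 4)) d u).weight x t =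
      j (weight t) * ∏ z ∈ K, u z ^ edgeCount (z - 1) z x t * d z ^ edgeCount z (z - 1) x t := by
  classical
  induction t generalizing x with
  | nil => simp [System.weight, weight, edgeCount]
  | node v a b iha ihb =>
    have h1 : ∀ c : BinaryTree Unit,
        ∏ z ∈ K, d z ^ (if c ≠ nil ∧ x = z ∧ x - 1 = z - 1 then 1 else 0) =
        if c = nil then 1 else d x := by
      intro c
      by_cases hc : c = nil
      · simp [hc]
      · have : ∀ z, (c ≠ nil ∧ x = z ∧ x - 1 = z - 1) ↔ x = z := fun z =>
          ⟨fun h => h.2.1, fun h => ⟨hc, h, by rw [h]⟩⟩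
        simp only [this, if_neg hc, pow_ite, pow_one, pow_zero, Finset.prod_ite_eq]
        split_ifs with hx
        · rfl
        · exact (hd x hx).symm
    have h2 : ∀ c : BinaryTree Unit,
        ∏ z ∈ K, u z ^ (if c ≠ nil ∧ x = z - 1 ∧ x + 1 = z then 1 else 0) =
        if c = nil then 1 else u (x + 1) := by
      intro c
      by_cases hc : c = nil
      · simp [hc]
      · have : ∀ z, (c ≠ nil ∧ x = z - 1 ∧ x + 1 = z) ↔ x + 1 = z := fun z =>
          ⟨fun h => h.2.2, fun h => ⟨hc, by rw [← h]; ring, h⟩⟩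
        simp only [this, if_neg hc, pow_ite, pow_one, pow_zero, Finset.prod_ite_eq]
        split_ifs with hx
        · rfl
        · exact (hu _ hx).symm
    have h3 : ∀ (c : BinaryTree Unit) (z : ℤ),
        ¬ (c ≠ nil ∧ x = z - 1 ∧ x - 1 = z) ∧ ¬ (c ≠ nil ∧ x = z ∧ x + 1 = z - 1) := fun c z =>
      ⟨fun h => by omega, fun h => by omega⟩
    simp only [edgeCount, h3, if_false, zero_add, add_zero, pow_add, Finset.prod_mul_distrib, h1,
      h2]
    rw [weight_node, System.weight, iha, ihb]
    simp only [markedSystem, map_mul, Finset.prod_mul_distrib]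
    by_cases ha : a = nil <;> by_cases hb : b = nil <;>
      simp [ha, hb, weight, edgeCount] <;> ring

lemma weight_markedSystem_zero {R : Type} [CommSemiring R] (j : ℝ≥0∞ →+* R) {d u : ℤ → R}
    (K : Finset ℕ) (hd : ∀ z, (∀ k ∈ K, (k : ℤ) ≠ z) → d z = 1)
    (hu : ∀ z, (∀ k ∈ K, (k : ℤ) ≠ z) → u z = 1) (t : BinaryTree Unit) :
    (markedSystem (j (1 / 4)) d u).weight 0 t =
      j (weight t) * ∏ k ∈ K, u k ^ (profile k t).1 * d k ^ (profile k t).2 := by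
  classical
  rw [weight_markedSystem j (K.image (Nat.cast : ℕ → ℤ)), Finset.prod_image]
  · rfl
  · exact fun a _ b _ h => by exact_mod_cast h
  · exact fun z hz => hd z fun k hk h => hz (Finset.mem_image.2 ⟨k, hk, h⟩)
  · exact fun z hz => hu z fun k hk h => hz (Finset.mem_image.2 ⟨k, hk, h⟩)

/-- Power series with two variables for each level, which mark the edges into and out of it. -/
abbrev Marks : Type := MvPowerSeries (ℕ × Bool) ℝ≥0∞

/-- The exponents of the marks at the levels in `H` that correspond to a profile. -/
def exponents (H : Finset ℕ) (x : ℕ → ℕ × ℕ) : ℕ × Bool →₀ ℕ :=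
  ∑ k ∈ H, (Finsupp.single (k, true) (x k).1 + Finsupp.single (k, false) (x k).2)

lemma exponents_inj {H : Finset ℕ} {x y : ℕ → ℕ × ℕ} :
    exponents H x = exponents H y ↔ ∀ k ∈ H, x k = y k := by
  classical
  have h : ∀ (x : ℕ → ℕ × ℕ) (k : ℕ), k ∈ H →
      exponents H x (k, true) = (x k).1 ∧ exponents H x (k, false) = (x k).2 := by
    intro x k hk
    constructor
    · rw [exponents, Finsupp.finsetSum_apply, Finset.sum_eq_single k]
      · simp
      · intro b _ hb
        simp [hb]
      · exact fun h => absurd hk h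
    · rw [exponents, Finsupp.finsetSum_apply, Finset.sum_eq_single k]
      · simp
      · intro b _ hb
        simp [hb]
      · exact fun h => absurd hk h
  constructor
  · intro hxy k hk
    refine Prod.ext ?_ ?_
    · rw [← (h x k hk).1, hxy, (h y k hk).1]
    · rw [← (h x k hk).2, hxy, (h y k hk).2]
  · intro hxy
    exact Finset.sum_congr rfl fun k hk => by rw [hxy k hk]

lemma prod_marks (H : Finset ℕ) (x : ℕ → ℕ × ℕ) :
    ∏ k ∈ H, ((MvPowerSeries.X (k, true) : Marks) ^ (x k).1 *
        MvPowerSeries.X (k, false) ^ (x k).2) =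
      MvPowerSeries.monomial (exponents H x) 1 := by
  classical
  rw [exponents]
  induction H using Finset.induction_on with
  | empty => simp [MvPowerSeries.monomial_zero_eq_C_apply]
  | insert a s ha ih =>
    rw [Finset.prod_insert ha, ih, Finset.sum_insert ha, MvPowerSeries.X_pow_eq,
      MvPowerSeries.X_pow_eq, MvPowerSeries.monomial_mul_monomial,
      MvPowerSeries.monomial_mul_monomial]
    simp

lemma coeff_C_mul_prod_marks (H : Finset ℕ) (x y : ℕ → ℕ × ℕ) (a : ℝ≥0∞) :
    MvPowerSeries.coeff (exponents H x) (MvPowerSeries.C a * ∏ k ∈ H,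
      ((MvPowerSeries.X (k, true) : Marks) ^ (y k).1 * MvPowerSeries.X (k, false) ^ (y k).2)) =
      open Classical in if ∀ k ∈ H, y k = x k then a else 0 := by
  classical
  rw [prod_marks, MvPowerSeries.coeff_C_mul, MvPowerSeries.coeff_monomial]
  by_cases h : ∀ k ∈ H, y k = x k
  · rw [if_pos (exponents_inj.2 fun k hk => (h k hk).symm), if_pos h, mul_one]
  · rw [if_neg, if_neg h, mul_zero]
    exact fun h' => h fun k hk => (exponents_inj.1 h' k hk).symm

/-- The marks of the levels in `H`. -/
def levelMark (H : Finset ℕ) (b : Bool) (z : ℤ) : Marks :=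
  open Classical in if z ∈ H.image (Nat.cast : ℕ → ℤ) then MvPowerSeries.X (z.toNat, b) else 1

/-- The system with marks for the levels in `H`. -/
def lowerSystem (H : Finset ℕ) : System Marks :=
  markedSystem (MvPowerSeries.C (1 / 4)) (levelMark H false) (levelMark H true)

/-- The contribution of the part of the tree below level `m` to the law of the profile. -/
def lowerFactor (H : Finset ℕ) (m p q : ℕ) : Marks :=
  ∑ i ∈ antidiagonal p, i.1 • (coeff i.1 ((lowerSystem H).downSeries m 0) *
    coeff i.2 ((lowerSystem H).downSeries m (m - 1) ^ q))

section

variable {R : Type} [CommSemiring R] [TopologicalSpace R] [SumComplete R]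

/-- The system with marks for the edges between levels `m` and `m + 1` only. -/
def upperSystem (c δ ρ : R) (m : ℕ) : System R :=
  markedSystem c (fun z => if z = m + 1 then δ else 1) (fun z => if z = m + 1 then ρ else 1)

/-- This is `two_type_lagrange` for the cut between `m - 1` and `m`: marks below `m` end up in
`lowerFactor`, marks above in the power of `upSeries`. The semiring `R` and the marks `δ`, `ρ` are
left free so that the case with level `m + 1` ignored and the case with it recorded share the same
lower factor. -/
theorem nsmul_tsum_profile (H : Finset ℕ) {m : ℕ} (hm : 1 ≤ m) (hH : ∀ k ∈ H, k < m)
    {i : Marks →+* R} (hi : PreservesTsum i) (δ ρ : R) (p q : ℕ) :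
    p • ∑' t, (if profile m t = (p, q) then i (MvPowerSeries.C (treeLaw t) * ∏ k ∈ H,
        (MvPowerSeries.X (k, true) ^ (profile k t).1 *
          MvPowerSeries.X (k, false) ^ (profile k t).2)) *
        (ρ ^ (profile (m + 1) t).1 * δ ^ (profile (m + 1) t).2) else 0) =
      coeff q ((upperSystem (i (MvPowerSeries.C (1 / 4))) δ ρ m).upSeries (m - 1) m ^ p) *
        i (lowerFactor H m p q) := by
  classical
  set j : R →+* PowerSeries (PowerSeries R) := C.comp C with hj
  have hjt : PreservesTsum j := preservesTsum_C.comp preservesTsum_C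
  -- The inner variable `C X` marks the edges from `m` to `m - 1`, the outer variable `X` those from
  -- `m - 1` to `m`.
  set d : ℤ → PowerSeries (PowerSeries R) := fun z => if z = m + 1 then j δ else
    if z = m then C X else j (i (levelMark H false z)) with hd
  set u : ℤ → PowerSeries (PowerSeries R) := fun z => if z = m + 1 then j ρ else
    if z = m then X else j (i (levelMark H true z)) with hu
  set k : ℝ≥0∞ →+* PowerSeries (PowerSeries R) :=
    j.comp (i.comp MvPowerSeries.C) with hk
  set Q := markedSystem (k (1 / 4)) d u with hQ
  have hlm : ∀ b (z : ℤ), (∀ n ∈ H, (n : ℤ) ≠ z) → levelMark H b z = 1 := by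
    intro b z hz
    rw [levelMark, if_neg]
    rintro h
    obtain ⟨n, hn, h⟩ := Finset.mem_image.1 h
    exact hz n hn h
  have hl0 : ∀ b (z : ℤ), (m : ℤ) ≤ z → levelMark H b z = 1 := fun b z hz =>
    hlm b z fun n hn => by have := hH n hn; omega
  have hU : Q.total m = evalAt j (C X * Q.total (m - 1))
      ((upperSystem (i (MvPowerSeries.C (1 / 4))) δ ρ m).upSeries (m - 1) m) := by
    have := System.evalAt_upSeries hjt (P := upperSystem (i (MvPowerSeries.C (1 / 4))) δ ρ m)
      (Q := Q) (l := (m : ℤ) - 1) (x := m) (by omega) ?_ ?_ ?_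
    · rw [← this]
      congr 3
      simp [hQ, markedSystem, hd]
    · intro z hz
      simp [hQ, markedSystem, upperSystem, hk]
    · intro z hz
      by_cases h : z = m + 1
      · simp [hQ, markedSystem, upperSystem, hd, h]
      · simp [hQ, markedSystem, upperSystem, hd, h, show z ≠ m by omega, hl0 _ z (by omega)]
    · intro z hz
      by_cases h : z = m
      · simp [hQ, markedSystem, upperSystem, hu, h]
      · simp [hQ, markedSystem, upperSystem, hu, h, show z + 1 ≠ m by omega,
          hl0 _ (z + 1) (by omega)]
  have hD : ∀ x : ℤ, x < m → Q.total x = evalAt j (X * Q.total m)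
      (PowerSeries.map i ((lowerSystem H).downSeries m x)) := by
    intro x hx
    have := System.evalAt_downSeries (hjt.comp hi) (P := lowerSystem H) (Q := Q) (l := m)
      (x := x) hx ?_ ?_ ?_
    · rw [evalAt_map, ← this]
      congr 3
      simp [hQ, markedSystem, hu]
    · intro z hz
      simp [hQ, markedSystem, lowerSystem, hk]
    · intro z hz
      simp [hQ, markedSystem, lowerSystem, hd, show z ≠ m + 1 by omega, show z ≠ m by omega]
    · intro z hz
      simp [hQ, markedSystem, lowerSystem, hu, show z ≠ m by omega, show z + 1 ≠ m by omega]
  have key := two_type_lagrange hU (hD _ (by omega)) (hD 0 (by omega)) p q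
  have hlow : i (lowerFactor H m p q) = ∑ a ∈ antidiagonal p,
      a.1 • (coeff a.1 (PowerSeries.map i ((lowerSystem H).downSeries m 0)) *
        coeff a.2 (PowerSeries.map i ((lowerSystem H).downSeries m (m - 1)) ^ q)) := by
    rw [lowerFactor, map_sum]
    refine Finset.sum_congr rfl fun a _ => ?_
    rw [map_nsmul, map_mul, ← map_pow, coeff_map, coeff_map]
  rw [hlow, ← key, System.total, PowerSeries.coeff_tsum, PowerSeries.coeff_tsum]
  congr 1
  refine tsum_congr fun t => ?_
  by_cases ht : t = nil
  · subst ht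
    simp [treeLaw_nil]
  rw [if_neg ht, treeLaw_of_ne_nil ht, hQ,
    weight_markedSystem_zero k (insert (m + 1) (insert m H))]
  · rw [Finset.prod_insert, Finset.prod_insert (fun h => (hH m h).false)]
    · have h1 : ∏ n ∈ H, u n ^ (profile n t).1 * d n ^ (profile n t).2 = j (i (∏ n ∈ H,
          (MvPowerSeries.X (n, true) ^ (profile n t).1 *
            MvPowerSeries.X (n, false) ^ (profile n t).2))) := by
        rw [map_prod, map_prod]
        refine Finset.prod_congr rfl fun n hn => ?_
        have := hH n hn
        have h2 : (n : ℤ) ∈ H.image (Nat.cast : ℕ → ℤ) := Finset.mem_image_of_mem _ hn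
        have h3 : ∀ b, levelMark H b n = MvPowerSeries.X (n, b) := fun b => by
          rw [levelMark, if_pos h2, Int.toNat_natCast]
        simp [hu, hd, h3, show (n : ℤ) ≠ m + 1 by omega, show n ≠ m by omega]
      have h4 : k (weight t) * (u ((m + 1 : ℕ) : ℤ) ^ (profile (m + 1) t).1 *
          d ((m + 1 : ℕ) : ℤ) ^ (profile (m + 1) t).2 *
          (u m ^ (profile m t).1 * d m ^ (profile m t).2 *
            ∏ n ∈ H, u n ^ (profile n t).1 * d n ^ (profile n t).2)) =
          X ^ (profile m t).1 * C (X ^ (profile m t).2 * C (i (MvPowerSeries.C (weight t) * ∏ n ∈ H,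
            (MvPowerSeries.X (n, true) ^ (profile n t).1 *
              MvPowerSeries.X (n, false) ^ (profile n t).2)) *
          (ρ ^ (profile (m + 1) t).1 * δ ^ (profile (m + 1) t).2))) := by
        rw [h1]
        simp only [hu, hd, hk, hj, RingHom.comp_apply, map_mul, map_pow]
        simp
        ring
      rw [h4, coeff_mul_C, coeff_X_pow]
      by_cases hp : p = (profile m t).1
      · rw [if_pos hp, one_mul, coeff_mul_C, coeff_X_pow]
        by_cases hq : q = (profile m t).2
        · rw [if_pos hq, one_mul, if_pos (by rw [hp, hq])]
        · rw [if_neg hq, zero_mul, if_neg (fun h => hq (by rw [h]))]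
      · rw [if_neg hp, zero_mul, map_zero, if_neg (fun h => hp (by rw [h]))]
    · intro h
      rcases Finset.mem_insert.1 h with h | h
      · omega
      · have := hH _ h
        omega
  · intro z hz
    have h1 := hz (m + 1) (by simp)
    have h2 := hz m (by simp)
    push_cast at h1
    simp [hd, h1.symm, h2.symm, hlm false z fun n hn => hz n (by simp [hn])]
  · intro z hz
    have h1 := hz (m + 1) (by simp)
    have h2 := hz m (by simp)
    push_cast at h1
    simp [hu, h1.symm, h2.symm, hlm true z fun n hn => hz n (by simp [hn])]

end

/-- The event that the profile takes given values at the levels in `H`. -/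
def profileEvent (H : Finset ℕ) (x : ℕ → ℕ × ℕ) : Set (BinaryTree Unit) :=
  {t | ∀ k ∈ H, profile k t = x k}

/-- With `δ = ρ = 1` the upper part is the plain excursion series; the coefficient at `exponents H
x` selects the prescribed past. -/
theorem mul_treeLaw_profileEvent (H : Finset ℕ) {m : ℕ} (hm : 1 ≤ m) (hH : ∀ k ∈ H, k < m)
    (x : ℕ → ℕ × ℕ) (p q : ℕ) :
    p * treeLaw.toMeasure (profileEvent H x ∩ {t | profile m t = (p, q)}) =
      coeff q (excursionSeries ^ p) *
        MvPowerSeries.coeff (exponents H x) (lowerFactor H m p q) := by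
  classical
  have h := nsmul_tsum_profile H hm hH (R := Marks) (i := RingHom.id _) (fun _ => rfl) 1 1 p q
  have hU : (upperSystem ((MvPowerSeries.C (1 / 4) : Marks)) 1 1 m).upSeries (m - 1) m =
      PowerSeries.map MvPowerSeries.C excursionSeries := by
    have := upSeries_eq_map_excursionSeries preservesTsum_MvC (l := (m : ℤ) - 1)
      (P := upperSystem ((MvPowerSeries.C (1 / 4) : Marks)) 1 1 m) (fun _ _ => rfl)
      (fun _ _ => by simp [upperSystem, markedSystem])
      (fun _ _ => by simp [upperSystem, markedSystem])
    rwa [sub_add_cancel] at this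
  simp only [RingHom.id_apply, one_pow, mul_one] at h
  rw [hU, ← map_pow, coeff_map] at h
  have h' := congrArg (MvPowerSeries.coeff (exponents H x)) h
  rw [map_nsmul, SumComplete.coeff_tsum, MvPowerSeries.coeff_C_mul, nsmul_eq_mul] at h'
  rw [← h', treeLaw_apply]
  congr 1
  refine tsum_congr fun t => ?_
  by_cases hp : profile m t = (p, q)
  · rw [if_pos hp, coeff_C_mul_prod_marks H x fun k => profile k t]
    by_cases hx : ∀ k ∈ H, profile k t = x k
    · rw [if_pos hx, if_pos ⟨hx, hp⟩]
    · rw [if_neg hx, if_neg fun h => hx h.1]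
  · rw [if_neg hp, map_zero, if_neg fun h => hp h.2]

/-- The lower coefficient is the one of `mul_treeLaw_profileEvent`; only the upper factor is
refined, through `coeff_upSeries_pow`. Hence the quotient forgets `H` and `x`. -/
theorem mul_treeLaw_profileEvent_succ (H : Finset ℕ) {m : ℕ} (hm : 1 ≤ m) (hH : ∀ k ∈ H, k < m)
    (x : ℕ → ℕ × ℕ) (p q r s : ℕ) :
    (p + s) * (p * treeLaw.toMeasure (profileEvent H x ∩ {t | profile m t = (p, q)} ∩
      {t | profile (m + 1) t = (r, s)})) =
      p * ((1 / 4) ^ (p + s) * (p + s).choose q * (p + s).choose r *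
        coeff s (excursionSeries ^ r)) *
        MvPowerSeries.coeff (exponents H x) (lowerFactor H m p q) := by
  classical
  have h := nsmul_tsum_profile H hm hH (R := PowerSeries (PowerSeries Marks)) (i := C.comp C)
    (preservesTsum_C.comp preservesTsum_C) X (C X) p q
  have hU := coeff_upSeries_pow (preservesTsum_MvC (σ := ℕ × Bool) (R := ℝ≥0∞)) (l := (m : ℤ) - 1)
    (P := upperSystem ((C.comp C) ((MvPowerSeries.C (1 / 4) : Marks))) X (C X) m) (fun _ _ => rfl)
    (by simp [upperSystem, markedSystem]; intro h; omega)
    (fun z hz => by simp [upperSystem, markedSystem, show z ≠ m + 1 by omega])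
    (by simp [upperSystem, markedSystem])
    (fun z hz => by simp [upperSystem, markedSystem, show z ≠ m by omega]) p q r s
  rw [sub_add_cancel] at hU
  have h1 := congrArg (fun f => coeff r (coeff s f)) h
  simp only [RingHom.comp_apply, coeff_mul_C] at h1
  have h' : MvPowerSeries.coeff (exponents H x) _ = _ := congrArg
    (fun g => MvPowerSeries.coeff (exponents H x) (g * lowerFactor H m p q)) hU
  simp only [smul_mul_assoc, RingHom.comp_apply] at h'
  rw [← h1] at h'
  simp only [map_nsmul, MvPowerSeries.coeff_C_mul, PowerSeries.coeff_tsum,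
    SumComplete.coeff_tsum] at h'
  simp only [nsmul_eq_mul, ← mul_assoc] at h'
  simp only [← mul_assoc]
  push_cast at h'
  rw [← h', treeLaw_apply]
  congr 1
  refine tsum_congr fun t => ?_
  by_cases hp : profile m t = (p, q)
  · rw [if_pos hp]
    have hmon : ∀ (a : Marks) (i j : ℕ), C (C a) * ((C X) ^ i * X ^ j) =
        (X ^ j * C (X ^ i * C a) : PowerSeries (PowerSeries Marks)) := by
      intro a i j
      rw [map_mul, map_pow]
      ring
    rw [mul_assoc, hmon, coeff_mul_C, coeff_X_pow]
    by_cases hs : s = (profile (m + 1) t).2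
    · rw [if_pos hs, one_mul, coeff_mul_C, coeff_X_pow]
      by_cases hr : r = (profile (m + 1) t).1
      · rw [if_pos hr, one_mul, coeff_C_mul_prod_marks H x fun k => profile k t]
        have hrs : profile (m + 1) t = (r, s) := by rw [hr, hs]
        by_cases hx : ∀ k ∈ H, profile k t = x k
        · rw [if_pos hx, if_pos ⟨⟨hx, hp⟩, hrs⟩]
        · rw [if_neg hx, if_neg fun h => hx h.1.1]
      · rw [if_neg hr, zero_mul, map_zero, if_neg]
        exact fun h => hr (congrArg Prod.fst h.2).symm
    · rw [if_neg hs, zero_mul, map_zero, map_zero, if_neg]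
      exact fun h => hs (congrArg Prod.snd h.2).symm
  · rw [if_neg hp, map_zero, map_zero, map_zero, if_neg fun h => hp h.1.2]

end IncBinTree

/-! ### The law of the number of endpoints of an excursion -/

namespace IncBinTree

open BinaryTree

namespace System

lemma weight_map_C_absorb {R : Type} [CommSemiring R] (P : System R) (l x : ℤ)
    (t : BinaryTree Unit) :
    ((P.map C).absorb l X).weight x t =
      C ((P.absorb l 1).weight x t) * X ^ labelCount l x t := by
  induction t generalizing x with
  | nil => simp [weight, labelCount]
  | node u a b iha ihb =>
    rw [weight, weight, iha, ihb, labelCount]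
    by_cases hx : x = l
    · subst hx
      by_cases ha : a = nil <;> by_cases hb : b = nil <;>
        simp [absorb, ha, hb, labelCount]
    · by_cases ha : a = nil <;> by_cases hb : b = nil <;>
        simp [absorb, System.map, ha, hb, labelCount, hx, pow_add] <;> ring

end System

lemma weight_baseSystem (x : ℤ) (t : BinaryTree Unit) : baseSystem.weight x t = weight t := by
  induction t generalizing x with
  | nil => rfl
  | node u a b iha ihb =>
    rw [System.weight, iha, ihb, weight_node]
    by_cases ha : a = nil <;> by_cases hb : b = nil <;> simp [baseSystem, weight, ha, hb]

lemma total_baseSystem (x : ℤ) : baseSystem.total x = 1 := by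
  simp only [System.total, weight_baseSystem]
  exact tsum_law

/-- The subtrees cut off at level `0` have total mass one, so a truncated tree has the same
probability as its absorbed weight with `y = 1`. -/
lemma coeff_excursionSeries (k : ℕ) : coeff k excursionSeries = nu k := by
  classical
  have h0 : ((baseSystem.map C).freeDown (0 + 1)) = baseSystem.map C := by
    ext z <;> by_cases h1 : z = 1 <;>
      simp [System.map, System.freeDown, baseSystem, h1]
  rw [excursionSeries, System.upSeries, h0, System.total, PowerSeries.coeff_tsum]
  have h1 : ∀ t', coeff k (if t' = nil then 0 else ((baseSystem.map C).absorb 0 X).weight 1 t') =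
      ∑' t, if t' = truncate 0 1 t then
        (if k = labelCount 0 1 (truncate 0 1 t) then treeLaw t else 0) else 0 := by
    intro t'
    by_cases ht' : t' = nil
    · subst ht'
      rw [if_pos rfl, map_zero]
      refine ((tsum_congr fun t => ?_).trans tsum_zero).symm
      by_cases ht : t = nil
      · subst ht
        simp [treeLaw_nil]
      · rw [if_neg]
        exact fun h' => ht (System.truncate_eq_nil.1 h'.symm)
    · rw [if_neg ht', System.weight_map_C_absorb, coeff_C_mul, coeff_X_pow,
        ← total_baseSystem 0, ← System.tsum_truncate_eq, tsum_mul']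
      refine tsum_congr fun t => ?_
      by_cases h : truncate 0 1 t = t'
      · have ht : t ≠ nil := fun h' => ht' (by rw [← h, h', truncate])
        subst h
        rw [if_pos rfl, if_pos rfl, weight_baseSystem, treeLaw_of_ne_nil ht, total_baseSystem,
          mul_ite, mul_one, mul_zero]
      · rw [if_neg h, if_neg (Ne.symm h), zero_mul]
  rw [tsum_congr h1, tsum_swap, nu, excursionLaw, PMF.map_comp, PMF.map_apply]
  exact tsum_congr fun t => by rw [tsum_ite_eq]; congr

lemma coeff_excursionSeries_pow (k l : ℕ) : coeff l (excursionSeries ^ k) = walkLaw k l := by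
  classical
  induction k generalizing l with
  | zero => simp [walkLaw, coeff_one, PMF.pure_apply]
  | succ k ih =>
    rw [pow_succ, coeff_mul, walkLaw, PMF.bind_apply,
      Finset.Nat.sum_antidiagonal_eq_sum_range_succ
        (fun i j => coeff i (excursionSeries ^ k) * coeff j excursionSeries),
      tsum_eq_sum (s := Finset.range (l + 1))]
    · refine Finset.sum_congr rfl fun a ha => ?_
      have ha' : a ≤ l := by simpa [Nat.lt_succ_iff] using ha
      rw [ih, coeff_excursionSeries, PMF.map_apply, tsum_eq_single (l - a)]
      · rw [if_pos (by omega)]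
      · intro n hn
        rw [if_neg (by omega)]
    · intro a ha
      have ha' : l < a := by simpa [Nat.lt_succ_iff] using ha
      rw [PMF.map_apply, ENNReal.tsum_eq_zero.2, mul_zero]
      intro n
      rw [if_neg (by omega)]

/-- Bounded solutions of the recursion `a (n + 1) = (1 + a n) (1 + a (n + 2)) / 4` are determined
by their initial values. -/
lemma eq_of_recursion {a b : ℕ → ℝ} (ha : ∀ n, a n ∈ Set.Icc (0 : ℝ) 1)
    (hb : ∀ n, b n ∈ Set.Icc (0 : ℝ) 1)
    (ha' : ∀ n, a (n + 1) = 1 / 4 * (1 + a n) * (1 + a (n + 2)))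
    (hb' : ∀ n, b (n + 1) = 1 / 4 * (1 + b n) * (1 + b (n + 2))) (h0 : a 0 = b 0) :
    a 1 = b 1 := by
  set D : ℕ → ℝ := fun n => |a n - b n| with hD
  -- Convexity of `D`: both coefficients in `h1` are at most `1/2`. With `D 0 = 0` this forces `D n
  -- ≥ n D 1`, which contradicts `D n ≤ 1` unless `D 1 = 0`.
  have hconv : ∀ n, D (n + 1) ≤ 1 / 2 * D n + 1 / 2 * D (n + 2) := by
    intro n
    have h1 : a (n + 1) - b (n + 1) = 1 / 4 * (1 + a (n + 2)) * (a n - b n) +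
        1 / 4 * (1 + b n) * (a (n + 2) - b (n + 2)) := by
      rw [ha', hb']
      ring
    have h2 := (ha (n + 2)).1
    have h3 := (ha (n + 2)).2
    have h4 := (hb n).1
    have h5 := (hb n).2
    simp only [hD]
    rw [h1]
    refine (abs_add_le _ _).trans ?_
    rw [abs_mul (1 / 4 * (1 + a (n + 2))), abs_mul (1 / 4 * (1 + b n)),
      abs_of_nonneg (a := 1 / 4 * (1 + a (n + 2))) (by positivity),
      abs_of_nonneg (a := 1 / 4 * (1 + b n)) (by positivity)]
    gcongr <;> linarith
  have hinc : ∀ n, D 1 ≤ D (n + 1) - D n := by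
    intro n
    induction n with
    | zero => simp [hD, h0]
    | succ n ih =>
      have := hconv n
      linarith
  have hgrow : ∀ n : ℕ, n * D 1 ≤ D n := by
    intro n
    induction n with
    | zero => simp [hD]
    | succ n ih =>
      have := hinc n
      push_cast
      linarith
  have hle : ∀ n, D n ≤ 1 := fun n => by
    rw [hD]
    exact abs_sub_le_iff.2 ⟨by linarith [(ha n).2, (hb n).1], by linarith [(ha n).1, (hb n).2]⟩
  by_contra hne
  have hpos : 0 < D 1 := abs_pos.2 (sub_ne_zero.2 hne)
  obtain ⟨n, hn⟩ := exists_nat_gt (1 / D 1)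
  have := (div_lt_iff₀ hpos).1 hn
  linarith [hgrow n, hle n]

/-- The explicit solution of the recursion of `eq_of_recursion`. -/
def explicitSolution (y : ℝ) (n : ℕ) : ℝ := 1 - 12 / ((y + n) ^ 2 - 1 / 4)

lemma explicitSolution_mem {y : ℝ} (hy : 7 / 2 ≤ y) (n : ℕ) :
    explicitSolution y n ∈ Set.Icc (0 : ℝ) 1 := by
  have h : (12 : ℝ) ≤ (y + n) ^ 2 - 1 / 4 := by
    have : (0 : ℝ) ≤ n := n.cast_nonneg
    nlinarith
  rw [explicitSolution]
  refine ⟨?_, ?_⟩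
  · rw [sub_nonneg, div_le_one (by linarith)]
    exact h
  · have : 0 ≤ 12 / ((y + n) ^ 2 - 1 / 4) := div_nonneg (by norm_num) (by linarith)
    linarith

lemma explicitSolution_succ {y : ℝ} (hy : 7 / 2 ≤ y) (n : ℕ) :
    explicitSolution y (n + 1) =
      1 / 4 * (1 + explicitSolution y n) * (1 + explicitSolution y (n + 2)) := by
  simp only [explicitSolution]
  push_cast
  have hn : (0 : ℝ) ≤ n := n.cast_nonneg
  -- The denominators factor, and `1 + a n = 2 (v - 2)(v + 3) / (v (v + 1))`; in the product with
  -- the same expression at `v + 2`, the factors `v` and `v + 3` cancel.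
  obtain ⟨v, hv⟩ : ∃ v, v = y + n - 1 / 2 := ⟨_, rfl⟩
  rw [show (y + n) ^ 2 - 1 / 4 = v * (v + 1) by rw [hv]; ring,
    show (y + (n + 1)) ^ 2 - 1 / 4 = (v + 1) * (v + 2) by rw [hv]; ring,
    show (y + (n + 2)) ^ 2 - 1 / 4 = (v + 2) * (v + 3) by rw [hv]; ring]
  have h1 : v ≠ 0 := by linarith
  have h2 : v + 1 ≠ 0 := by linarith
  have h3 : v + 2 ≠ 0 := by linarith
  have h4 : v + 3 ≠ 0 := by linarith
  field_simp
  ring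

/-- The parameter `y` solves `y^2 - 1/4 = 12 / (1 - z)`, which is the initial condition. Its least
value `7/2`, at `z = 0`, is the bound that keeps the solution in `[0, 1]`. -/
lemma explicitSolution_one {z : ℝ} (h0 : 0 ≤ z) (h1 : z < 1) :
    7 / 2 ≤ √(49 - z) / (2 * √(1 - z)) ∧
    explicitSolution (√(49 - z) / (2 * √(1 - z))) 0 = z ∧
    explicitSolution (√(49 - z) / (2 * √(1 - z))) 1 =
      (-z ^ 2 + 16 * z - 3 + √(49 - z) * (1 - z) ^ ((3 : ℝ) / 2)) / (2 * (z + 5)) := by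
  have hr : (1 - z) ^ ((3 : ℝ) / 2) = √(1 - z) ^ 3 := by
    rw [Real.sqrt_eq_rpow, ← Real.rpow_natCast, ← Real.rpow_mul (by linarith)]
    norm_num
  rw [hr]
  set c := √(1 - z) with hc
  set s := √(49 - z) with hs
  have hcp : 0 < c := Real.sqrt_pos.2 (by linarith)
  have hsp : 0 < s := Real.sqrt_pos.2 (by linarith)
  have hc2 : c ^ 2 = 1 - z := Real.sq_sqrt (by linarith)
  have hs2 : s ^ 2 = 49 - z := Real.sq_sqrt (by linarith)
  have hz : z = 1 - c ^ 2 := by linarith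
  have hs3 : s ^ 2 = 48 + c ^ 2 := by linarith
  have hc1 : c ^ 2 ≤ 1 := by linarith
  refine ⟨?_, ?_, ?_⟩
  · rw [le_div_iff₀ (by positivity)]
    nlinarith
  · have : (s / (2 * c) + ((0 : ℕ) : ℝ)) ^ 2 - 1 / 4 = 12 / c ^ 2 := by
      field_simp
      push_cast
      nlinarith
    rw [explicitSolution, this, hz]
    field_simp
  · have : (s / (2 * c) + ((1 : ℕ) : ℝ)) ^ 2 - 1 / 4 = (12 + c ^ 2 + s * c) / c ^ 2 := by
      field_simp
      push_cast
      nlinarith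
    rw [explicitSolution, this, hz]
    have h5 : (0 : ℝ) < 1 - c ^ 2 + 5 := by linarith
    have h6 : 0 < 12 + c ^ 2 + s * c := by positivity
    field_simp
    linear_combination (-c ^ 4) * hs3

/-- The total is a power series in `y` with nonnegative coefficients, hence monotone, and at `y = 1`
it is the mass of a probability law. -/
lemma total_absorb_baseSystem_le {y : ℝ≥0∞} (hy : y ≤ 1) (n : ℕ) :
    (baseSystem.absorb 0 y).total n ≤ 1 := by
  rcases Nat.eq_zero_or_pos n with rfl | hn
  · rw [Nat.cast_zero, System.total_absorb_self]
    exact hy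
  have key : ∀ y : ℝ≥0∞, (baseSystem.absorb 0 y).total n =
      evalAt (RingHom.id _) y (baseSystem.upSeries 0 n) := by
    intro y
    rw [← System.evalAt_upSeries (j := RingHom.id _) (fun _ => rfl) (P := baseSystem)
      (Q := baseSystem.absorb 0 y) (l := 0) (x := n) (by omega), System.total_absorb_self]
    · simp [System.absorb, baseSystem]
    · intro z hz
      simp [System.absorb, hz.ne']
    · intro z hz
      simp [System.absorb, show z ≠ 0 by omega]
    · intro z hz
      simp [System.absorb, hz.ne']
  calc (baseSystem.absorb 0 y).total n
      ≤ (baseSystem.absorb 0 (baseSystem.total 0)).total n := by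
        rw [key, key, total_baseSystem, evalAt_apply, evalAt_apply]
        gcongr
    _ = 1 := by rw [System.total_absorb_total, total_baseSystem]

theorem hasSum_nu {z : ℝ} (hz : z ∈ Set.Icc (0 : ℝ) 1) :
    HasSum (fun k : ℕ => (nu k).toReal * z ^ k)
      ((-z ^ 2 + 16 * z - 3 + √(49 - z) * (1 - z) ^ ((3 : ℝ) / 2)) / (2 * (z + 5))) := by
  set y := ENNReal.ofReal z with hy
  have hy1 : y ≤ 1 := by
    rw [hy, ← ENNReal.ofReal_one]
    exact ENNReal.ofReal_le_ofReal hz.2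
  set T : ℕ → ℝ≥0∞ := fun n => (baseSystem.absorb 0 y).total n with hT
  have hT1 : ∀ n, T n ≤ 1 := total_absorb_baseSystem_le hy1
  have hTtop : ∀ n, T n ≠ ∞ := fun n => ne_top_of_le_ne_top (by simp) (hT1 n)
  set a : ℕ → ℝ := fun n => (T n).toReal with ha
  have ha1 : ∀ n, a n ∈ Set.Icc (0 : ℝ) 1 := fun n =>
    ⟨ENNReal.toReal_nonneg, ENNReal.toReal_le_of_le_ofReal zero_le_one (by simpa using hT1 n)⟩
  have ha0 : a 0 = z := by
    simp only [ha, hT, Nat.cast_zero, System.total_absorb_self]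
    exact ENNReal.toReal_ofReal hz.1
  have harec : ∀ n, a (n + 1) = 1 / 4 * (1 + a n) * (1 + a (n + 2)) := by
    intro n
    have : T (n + 1) = 1 / 4 * (1 + T n) * (1 + T (n + 2)) := by
      simp only [hT]
      rw [System.total_eq]
      push_cast
      rw [add_sub_cancel_right, show (n : ℤ) + 1 + 1 = n + 2 by ring]
      simp [System.absorb, baseSystem, show (n : ℤ) + 1 ≠ 0 by omega]
    simp only [ha, this, ENNReal.toReal_mul]
    rw [ENNReal.toReal_add (by simp) (hTtop _), ENNReal.toReal_add (by simp) (hTtop _)]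
    simp
  have hsum : ∑' k, nu k * y ^ k = T 1 := by
    have := System.evalAt_upSeries (j := RingHom.id _) (fun _ => rfl) (P := baseSystem)
      (Q := baseSystem.absorb 0 y) (l := 0) (x := 1) (by norm_num)
      (fun z hz => by simp [System.absorb, hz.ne'])
      (fun z hz => by simp [System.absorb, show z ≠ 0 by omega])
      (fun z hz => by simp [System.absorb, hz.ne'])
    rw [System.total_absorb_self, ← excursionSeries, evalAt_apply] at this
    simp only [hT, Nat.cast_one]
    rw [← this]
    refine tsum_congr fun k => ?_
    rw [coeff_excursionSeries]
    simp [System.absorb, baseSystem]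
  have hfin : ∑' k, nu k * y ^ k ≠ ∞ := hsum ▸ hTtop 1
  have hval : a 1 =
      (-z ^ 2 + 16 * z - 3 + √(49 - z) * (1 - z) ^ ((3 : ℝ) / 2)) / (2 * (z + 5)) := by
    rcases hz.2.lt_or_eq with h | h
    · obtain ⟨e1, e2, e3⟩ := explicitSolution_one hz.1 h
      rw [← e3]
      exact eq_of_recursion ha1 (explicitSolution_mem e1) harec (explicitSolution_succ e1)
        (by rw [ha0, e2])
    -- At `z = 1` the parameter of the explicit solution would be infinite; its limit, the constant
    -- `1`, takes its place.
    · rw [eq_of_recursion (b := fun _ => 1) ha1 (fun _ => by simp) harec (fun _ => by norm_num)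
        (by rw [ha0, h])]
      rw [h, sub_self, Real.zero_rpow (by norm_num)]
      norm_num
  have h1 := ENNReal.hasSum_toReal hfin
  rw [← ENNReal.tsum_toReal_eq fun k => ENNReal.ne_top_of_tsum_ne_top hfin k, hsum] at h1
  rw [← hval]
  convert h1 using 2 with k
  rw [ENNReal.toReal_mul, ENNReal.toReal_pow, hy, ENNReal.toReal_ofReal hz.1]

/-! ### Positivity of all states -/

/-- A tree with root labelled `m`, with `q` edges from `m` to `m - 1` and none from `m - 1` to
`m`. -/
def excursionTree : ℕ → BinaryTree Unit
  | 0 => node () nil nil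
  | q + 1 => node () (node () nil nil) (node () (excursionTree q) nil)

/-- A tree with root labelled `m - 1`, with `p + 1` edges from `m - 1` to `m` and `q` edges from
`m` to `m - 1`. -/
def crossingTree (q : ℕ) : ℕ → BinaryTree Unit
  | 0 => node () nil (excursionTree q)
  | p + 1 => node () (node () nil (crossingTree q p)) (node () nil nil)

/-- The tree obtained by attaching a tree to a path of `n` right edges. -/
def climb (t : BinaryTree Unit) : ℕ → BinaryTree Unit
  | 0 => t
  | n + 1 => node () nil (climb t n)

lemma excursionTree_ne_nil (q : ℕ) : excursionTree q ≠ nil := by cases q <;> simp [excursionTree]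

lemma crossingTree_ne_nil (q p : ℕ) : crossingTree q p ≠ nil := by cases p <;> simp [crossingTree]

lemma climb_ne_nil {t : BinaryTree Unit} (ht : t ≠ nil) (n : ℕ) : climb t n ≠ nil := by
  cases n <;> simp [climb, ht]

lemma labelCount_truncate_excursionTree (q : ℕ) :
    labelCount 0 1 (truncate 0 1 (excursionTree q)) = q := by
  induction q with
  | zero => simp [excursionTree, truncate, labelCount]
  | succ q ih =>
    simp only [excursionTree, truncate]
    norm_num
    simp [labelCount, ih, add_comm]

lemma edgeCount_excursionTree (m : ℤ) (q : ℕ) :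
    edgeCount (m - 1) m m (excursionTree q) = 0 ∧
      edgeCount m (m - 1) m (excursionTree q) = q := by
  induction q with
  | zero => simp [excursionTree, edgeCount]
  | succ q ih =>
    have h1 : m ≠ m - 1 := by omega
    have h2 : m + 1 ≠ m - 1 := by omega
    have h3 : m + 1 ≠ m := by omega
    simp [excursionTree, edgeCount, ih, h1, h2, add_comm]

lemma edgeCount_crossingTree (m : ℤ) (q p : ℕ) :
    edgeCount (m - 1) m (m - 1) (crossingTree q p) = p + 1 ∧
      edgeCount m (m - 1) (m - 1) (crossingTree q p) = q := by
  have h1 : m - 1 ≠ m := by omega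
  have h2 : m - 1 - 1 ≠ m := by omega
  have h3 : m - 1 - 1 ≠ m - 1 := by omega
  induction p with
  | zero =>
    simp [crossingTree, edgeCount, edgeCount_excursionTree, excursionTree_ne_nil, h1]
  | succ p ih =>
    simp [crossingTree, edgeCount, ih, h1, h2, h3, add_comm]

lemma edgeCount_climb {m x : ℤ} (t : BinaryTree Unit) (n : ℕ) (hx : x + n = m - 1) :
    edgeCount (m - 1) m x (climb t n) = edgeCount (m - 1) m (m - 1) t ∧
      edgeCount m (m - 1) x (climb t n) = edgeCount m (m - 1) (m - 1) t := by
  induction n generalizing x with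
  | zero =>
    obtain rfl : x = m - 1 := by simpa using hx
    exact ⟨rfl, rfl⟩
  | succ n ih =>
    push_cast at hx
    have h1 : x ≠ m - 1 := by omega
    have h2 : x ≠ m := by omega
    have := ih (x := x + 1) (by omega)
    simp [climb, edgeCount, this, h1, h2]

lemma nu_pos (k : ℕ) : 0 < nu k := by
  rw [pos_iff_ne_zero, ← PMF.mem_support_iff, nu, excursionLaw, PMF.map_comp,
    PMF.mem_support_map_iff]
  refine ⟨excursionTree k, ?_, labelCount_truncate_excursionTree k⟩
  rw [PMF.mem_support_iff, treeLaw_of_ne_nil (excursionTree_ne_nil k), weight_eq]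
  simp

lemma walkLaw_pos {p : ℕ} (hp : 0 < p) (q : ℕ) : 0 < walkLaw p q := by
  obtain ⟨p, rfl⟩ := Nat.exists_eq_succ_of_ne_zero hp.ne'
  clear hp
  induction p generalizing q with
  | zero =>
    rw [← coeff_excursionSeries_pow, Nat.succ_eq_add_one, zero_add, pow_one, coeff_excursionSeries]
    exact nu_pos q
  | succ p ih =>
    rw [← coeff_excursionSeries_pow, pow_succ, coeff_mul]
    refine lt_of_lt_of_le ?_ (Finset.single_le_sum (fun _ _ => zero_le)
      (Finset.HasAntidiagonal.mem_antidiagonal (a := (q, 0)).2 (add_zero q)))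
    rw [coeff_excursionSeries_pow, coeff_excursionSeries]
    exact ENNReal.mul_pos (ih q).ne' (nu_pos 0).ne'

lemma walkLaw_pos_of_mem_states {p q : ℕ} (h : (p, q) ∈ states) : 0 < walkLaw p q := by
  rcases h with h | h
  · exact walkLaw_pos h q
  · obtain ⟨rfl, rfl⟩ := Prod.mk.inj h
    simp [walkLaw]

lemma f_pos {p q : ℕ} (h : (p, q) ∈ states) : 0 < f p q :=
  ENNReal.toReal_pos (walkLaw_pos_of_mem_states h).ne' (PMF.apply_ne_top _ _)

lemma treeLaw_profile_pos {p q m : ℕ} (h : (p, q) ∈ states) (hm : 1 ≤ m) :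
    0 < treeLaw.toMeasure {t | profile m t = (p, q)} := by
  obtain ⟨t, ht, htp⟩ : ∃ t, t ≠ nil ∧ profile m t = (p, q) := by
    rcases h with h | h
    -- The path of `m - 1` right edges leads from label `0` to `m - 1`; `crossingTree q (p - 1)`
    -- then has `p` upward crossings.
    · refine ⟨climb (crossingTree q (p - 1)) (m - 1), climb_ne_nil (crossingTree_ne_nil _ _) _, ?_⟩
      have h1 := edgeCount_climb (m := m) (x := 0) (crossingTree q (p - 1)) (m - 1) (by omega)
      have h2 : p - 1 + 1 = p := Nat.sub_add_cancel h
      rw [profile, h1.1, h1.2, (edgeCount_crossingTree m q (p - 1)).1,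
        (edgeCount_crossingTree m q (p - 1)).2, h2]
    · obtain ⟨rfl, rfl⟩ := Prod.mk.inj h
      exact ⟨node () nil nil, by simp, by simp [profile, edgeCount]⟩
  rw [treeLaw_apply]
  classical
  refine lt_of_lt_of_le ?_ (ENNReal.le_tsum t)
  rw [if_pos (show t ∈ {t | profile m t = (p, q)} from htp), treeLaw_of_ne_nil ht, weight_eq]
  exact ENNReal.pow_pos (by simp) _

/-! ### Conditional laws of the profile -/

lemma edgeCount_eq_zero_of_lt {m x : ℤ} {t : BinaryTree Unit} (hx : x < m)
    (h : edgeCount (m - 1) m x t = 0) :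
    edgeCount m (m + 1) x t = 0 ∧ edgeCount (m + 1) m x t = 0 := by
  induction t generalizing x with
  | nil => simp [edgeCount]
  | node u a b iha ihb =>
    simp only [edgeCount, Nat.add_eq_zero_iff] at h ⊢
    obtain ⟨⟨⟨-, h2⟩, h3⟩, h4⟩ := h
    have ha := iha (by omega) h3
    have hb : edgeCount m (m + 1) (x + 1) b = 0 ∧ edgeCount (m + 1) m (x + 1) b = 0 := by
      rcases (show x + 1 ≤ m by omega).lt_or_eq with h | h
      · exact ihb h h4
      -- A right child here would have label `m`, reached by an edge from `m - 1`.
      · have : b = nil := by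
          by_contra hb
          rw [if_pos ⟨hb, by omega, h⟩] at h2
          exact one_ne_zero h2
        simp [this, edgeCount]
    rw [ha.1, ha.2, hb.1, hb.2, if_neg (by omega), if_neg (by omega), if_neg (by omega),
      if_neg (by omega)]
    simp

lemma profile_succ_eq_zero {m : ℕ} (hm : 1 ≤ m) {t : BinaryTree Unit} (h : profile m t = (0, 0)) :
    profile (m + 1) t = (0, 0) := by
  have := edgeCount_eq_zero_of_lt (m := m) (x := 0) (by omega) (congrArg Prod.fst h)
  rw [profile]
  push_cast
  rw [add_sub_cancel_right, this.1, this.2]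

/-- For `p > 0` it is the quotient of `mul_treeLaw_profileEvent_succ` by `mul_treeLaw_profileEvent`.
For `p = 0` both identities are void, but then the tree never reaches level `m` and the next profile
is `(0, 0)`. -/
theorem cond_profile_succ (H : Finset ℕ) {m : ℕ} (hm : 1 ≤ m) (hH : ∀ k ∈ H, k < m)
    (x : ℕ → ℕ × ℕ) {p q r s : ℕ} (hpq : (p, q) ∈ states)
    (hpos : 0 < treeLaw.toMeasure (profileEvent H x ∩ {t | profile m t = (p, q)})) :
    (ProbabilityTheory.cond treeLaw.toMeasure
      (profileEvent H x ∩ {t | profile m t = (p, q)})).real {t | profile (m + 1) t = (r, s)} =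
      kernel p q r s := by
  set A := profileEvent H x ∩ {t | profile m t = (p, q)} with hA
  rw [MeasureTheory.measureReal_def,
    ProbabilityTheory.cond_apply (MeasurableSpace.measurableSet_top), ENNReal.toReal_mul,
    ENNReal.toReal_inv]
  have hAtop : treeLaw.toMeasure A ≠ ∞ := MeasureTheory.measure_ne_top _ _
  have ha : 0 < (treeLaw.toMeasure A).toReal := ENNReal.toReal_pos hpos.ne' hAtop
  rcases Nat.eq_zero_or_pos p with rfl | hp
  · obtain rfl : q = 0 := by
      rcases hpq with h | h
      · exact absurd h (lt_irrefl 0)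
      · exact (Prod.mk.inj h).2
    have h0 : ∀ t ∈ A, profile (m + 1) t = (0, 0) := fun t ht => profile_succ_eq_zero hm ht.2
    by_cases hrs : r = 0 ∧ s = 0
    · obtain ⟨rfl, rfl⟩ := hrs
      rw [Set.inter_eq_left.2 (show A ⊆ {t | profile (m + 1) t = (0, 0)} from h0),
        inv_mul_cancel₀ ha.ne']
      simp [kernel]
    · have : A ∩ {t | profile (m + 1) t = (r, s)} = ∅ := by
        ext t
        simp only [Set.mem_inter_iff, Set.mem_ofPred_eq, Set.mem_empty_iff_false, iff_false]
        rintro ⟨h1, h2⟩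
        rw [h0 t h1] at h2
        exact hrs ⟨(Prod.mk.inj h2).1.symm, (Prod.mk.inj h2).2.symm⟩
      simp [this, kernel, hrs]
  · have hF := walkLaw_pos_of_mem_states hpq
    have h1 := mul_treeLaw_profileEvent H hm hH x p q
    have h2 := mul_treeLaw_profileEvent_succ H hm hH x p q r s
    rw [coeff_excursionSeries_pow, ← hA] at h1
    rw [coeff_excursionSeries_pow, ← hA] at h2
    replace h1 := congrArg ENNReal.toReal h1
    replace h2 := congrArg ENNReal.toReal h2
    rw [ENNReal.toReal_mul, ENNReal.toReal_mul, ENNReal.toReal_natCast] at h1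
    rw [ENNReal.toReal_mul, ENNReal.toReal_mul, ENNReal.toReal_mul, ENNReal.toReal_mul,
      ENNReal.toReal_mul, ENNReal.toReal_mul, ENNReal.toReal_mul, ENNReal.toReal_pow,
      ENNReal.toReal_natCast, ENNReal.toReal_natCast, ENNReal.toReal_natCast, ← Nat.cast_add,
      ENNReal.toReal_natCast] at h2
    have hf := f_pos hpq
    change _ = f p q * _ at h1
    change _ = _ * (_ * f r s) * _ at h2
    have hp' : (0 : ℝ) < p := by exact_mod_cast hp
    have hc : 4 ^ (-(p : ℤ) - (s : ℤ)) = ((1 / 4 : ℝ≥0∞).toReal) ^ (p + s) := by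
      rw [show -(p : ℤ) - s = -((p + s : ℕ) : ℤ) by push_cast; ring, zpow_neg, zpow_natCast]
      simp
    rw [kernel, if_neg (fun h => hp.ne' h.1), hc]
    push_cast at h2
    have hps : (0 : ℝ) < p + s := by positivity
    field_simp
    -- Multiplying `h2` by `f p q` makes the right side of `h1` appear, which removes the lower
    -- factor without dividing by it.
    have h3 : (p : ℝ) * ((p + s) * f p q * (treeLaw.toMeasure
        (A ∩ {t | profile (m + 1) t = (r, s)})).toReal) = p * (p * (treeLaw.toMeasure A).toReal *
        (1 / 4 : ℝ≥0∞).toReal ^ (p + s) * (p + s).choose q * (p + s).choose r * f r s) := by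
      linear_combination f p q * h2 - p * (1 / 4 : ℝ≥0∞).toReal ^ (p + s) * (p + s).choose q *
        (p + s).choose r * f r s * h1
    have h4 := mul_left_cancel₀ hp'.ne' h3
    linear_combination h4

end IncBinTree

end

theorem theorem5p1 :
    (∀ z : ℝ, z ∈ Set.Icc (0 : ℝ) 1 →
      HasSum (fun k : ℕ => (IncBinTree.nu k).toReal * z ^ k)
        ((-z ^ 2 + 16 * z - 3 + Real.sqrt (49 - z) * (1 - z) ^ ((3 : ℝ) / 2)) / (2 * (z + 5)))) ∧
    ∀ p q r s : ℕ, (p, q) ∈ IncBinTree.states → (r, s) ∈ IncBinTree.states →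
      0 < IncBinTree.f p q ∧
      ∀ m : ℕ, 1 ≤ m →
        0 < IncBinTree.treeLaw.toMeasure {t | IncBinTree.profile m t = (p, q)} ∧
        (ProbabilityTheory.cond IncBinTree.treeLaw.toMeasure
            {t | IncBinTree.profile m t = (p, q)}).real
          {t | IncBinTree.profile (m + 1) t = (r, s)} = IncBinTree.kernel p q r s ∧
        ∀ x : ℕ → ℕ × ℕ, x m = (p, q) →
          0 < IncBinTree.treeLaw.toMeasure
            {t | ∀ k ∈ Finset.Icc 1 m, IncBinTree.profile k t = x k} →
          (ProbabilityTheory.cond IncBinTree.treeLaw.toMeasure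
              {t | ∀ k ∈ Finset.Icc 1 m, IncBinTree.profile k t = x k}).real
            {t | IncBinTree.profile (m + 1) t = (r, s)} = IncBinTree.kernel p q r s := by
  refine ⟨fun z hz => IncBinTree.hasSum_nu hz, fun p q r s hpq _ => ⟨IncBinTree.f_pos hpq,
    fun m hm => ⟨IncBinTree.treeLaw_profile_pos hpq hm, ?_, fun x hx hpos => ?_⟩⟩⟩
  · have h := IncBinTree.treeLaw_profile_pos hpq hm
    -- Conditioning on level `m` alone is the case of an empty past.
    have h0 : IncBinTree.profileEvent ∅ (fun _ => (0, 0)) ∩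
        {t | IncBinTree.profile m t = (p, q)} = {t | IncBinTree.profile m t = (p, q)} := by
      simp [IncBinTree.profileEvent]
    rw [← h0] at h ⊢
    exact IncBinTree.cond_profile_succ ∅ hm (by simp) _ hpq h
  -- The last level `m`, where `x m = (p, q)`, is split off; the levels in `Ico 1 m` form the past.
  · have h0 : {t | ∀ k ∈ Finset.Icc 1 m, IncBinTree.profile k t = x k} =
        IncBinTree.profileEvent (Finset.Ico 1 m) x ∩ {t | IncBinTree.profile m t = (p, q)} := by
      ext t
      rw [← Finset.Ico_insert_right hm]
      simp [IncBinTree.profileEvent, hx, and_comm]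
    rw [h0] at hpos ⊢
    exact IncBinTree.cond_profile_succ _ hm (fun k hk => (Finset.mem_Ico.1 hk).2) x hpq hpos
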